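/- Let $k\ge 2$ be an integer and $\alpha>0$. Let $(I_t)_{t\ge 0}$ be the $k$-regular self-similar fragmentation process of index $\alpha$: it starts with the single interval $I_0=[0,1)$, and each interval of size $u\in(0,1]$, independently of all other intervals, waits after its creation for an exponential time with mean $u^{-\alpha}$ and then breaks into $k$ intervals of equal size. Put $\gamma:=\log k$, $\kappa:=\frac{1}{\gamma\alpha}$, $\mu_2:=2\kappa^{2/3}$, $c:=-\frac{1}{2\kappa}-\log\kappa+\gamma-\frac12\log(2\gamma)+1$ and $$h(t):=\kappa\left(\log t+\sqrt{2\gamma\log t}-\tfrac12\log\log t+c\right).$$ Almost surely, for every $t\ge 0$ the system has a smallest fragment and its size is $k^{-M_t}$ for some integer $M_t\geq 0$, and there is a (random) $t_0\in[0,\infty)$ such that for all $t\ge t_0$ $$M_t\in\left\{\left\lceil h(t)-\mu_2(\log t)^{-1/3}\right\rceil,\ \left\lceil h(t)+\mu_2(\log t)^{-1/3}\right\rceil\right\}.$$ This holds both when $\lceil x\rceil$ denotes the least integer greater than or equal to $x$ and when it denotes the least integer strictly greater than $x$. -/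

import Mathlib

open MeasureTheory ProbabilityTheory

namespace RegularFragmentation

noncomputable section

/-!
A word `v : List (Fin k)` of length `n` labels one of the `k ^ n` subintervals
`[m / k ^ n, (m + 1) / k ^ n)` of `[0, 1)`. The empty word labels `[0, 1)`, and `d :: v` labels
the `d`-th of the `k` equal pieces of the interval labelled by `v`.
-/

/-- The size `k ^ (-n)` of the interval labelled by a word of length `n`. -/
def size {k : ℕ} (v : List (Fin k)) : ℝ := (k : ℝ) ^ (-(v.length : ℤ))

/-- The left end point of the interval labelled by a word. -/
def left {k : ℕ} : List (Fin k) → ℝ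
  | [] => 0
  | d :: v => left v + (d : ℕ) * (size v / k)

/-- The interval labelled by a word. -/
def interval {k : ℕ} (v : List (Fin k)) : Set ℝ := Set.Ico (left v) (left v + size v)

/-- The time at which the interval labelled by a word breaks, given the waiting times `L` of all
intervals: a piece is created when its parent breaks, and then waits for its own waiting time. -/
def breakTime {k : ℕ} (L : List (Fin k) → ℝ) : List (Fin k) → ℝ
  | [] => L []
  | d :: v => breakTime L v + L (d :: v)

/-- The time at which the interval labelled by a word is created: the interval `[0, 1)` is there
at time `0`, and any other interval is created when its parent breaks. -/
def creationTime {k : ℕ} (L : List (Fin k) → ℝ) : List (Fin k) → ℝ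
  | [] => 0
  | _ :: v => breakTime L v

/-- `(I t)`, `t ≥ 0`, is a `k`-regular self-similar fragmentation process of index `α`; here
`I t ω` is the collection of the intervals (the fragments) that are present at time `t`. The process
starts from the single interval `[0, 1)`; every interval, independently of all others, waits from
its creation for an exponential time with rate `u ^ α` (so with mean `u ^ (-α)`), where `u` is its
size, and then breaks into its `k` equal pieces. -/
def IsRegularFragmentation {Ω : Type*} [MeasurableSpace Ω] (P : Measure Ω) (k : ℕ) (α : ℝ)
    (I : ℝ → Ω → Set (Set ℝ)) : Prop :=
  ∃ L : List (Fin k) → Ω → ℝ,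
    (∀ v, HasLaw (L v) (expMeasure (size v ^ α)) P) ∧
    iIndepFun L P ∧
    ∀ᵐ ω ∂P, ∀ t : ℝ, 0 ≤ t →
      I t ω = {J | ∃ v : List (Fin k), J = interval v ∧
        creationTime (fun w => L w ω) v ≤ t ∧ t < breakTime (fun w => L w ω) v}

/-- The set of the sizes (lengths) of the intervals in a collection. -/
def fragmentSizes (F : Set (Set ℝ)) : Set ℝ := (fun J => (volume J).toReal) '' F

/-- `γ = log k`. -/
def gam (k : ℕ) : ℝ := Real.log k

/-- `κ = 1 / (γ α)`. -/
def kap (k : ℕ) (α : ℝ) : ℝ := 1 / (gam k * α)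

/-- `c = -1 / (2 κ) - log κ + γ - (1 / 2) log (2 γ) + 1`. -/
def cst (k : ℕ) (α : ℝ) : ℝ :=
  -(1 / (2 * kap k α)) - Real.log (kap k α) + gam k - 1 / 2 * Real.log (2 * gam k) + 1

/-- `h(t) = κ (log t + √(2 γ log t) - (1 / 2) log log t + c)`. -/
def h (k : ℕ) (α : ℝ) (t : ℝ) : ℝ :=
  kap k α * (Real.log t + Real.sqrt (2 * gam k * Real.log t)
    - 1 / 2 * Real.log (Real.log t) + cst k α)

/-- `μ₂ = 2 κ ^ (2 / 3)`. -/
def mu2 (k : ℕ) (α : ℝ) : ℝ := 2 * kap k α ^ (2 / 3 : ℝ)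

/-- The lower argument `h(t) - μ₂ (log t) ^ (-1 / 3)`. -/
def hLower (k : ℕ) (α : ℝ) (t : ℝ) : ℝ := h k α t - mu2 k α * (1 / Real.log t ^ (1 / 3 : ℝ))

/-- The upper argument `h(t) + μ₂ (log t) ^ (-1 / 3)`. -/
def hUpper (k : ℕ) (α : ℝ) (t : ℝ) : ℝ := h k α t + mu2 k α * (1 / Real.log t ^ (1 / 3 : ℝ))

end

end RegularFragmentation

/-! Put A = γα, so that an interval of level i breaks at rate e^{-Ai}, and write t = e^s. `M t` is
the largest level reached by time t, and level n + 1 is reached exactly when some interval of level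
n has broken. So the task is to locate, for each N, the first break at level N: the minimum over k^N
correlated branches of a sum of N + 1 independent exponential times.

With x = NA - s, the product of t and the rate of level N - i is e^{-(x - Ai)}. Only the deepest m =
⌈x/A⌉ levels are slow on the scale t. Their waiting times sum to at most t with probability about
t^m/m! times the product of their rates, while all the faster levels together cost a factor
e^{O(log² N)}. Stirling then gives e^{`logMean`}, up to such factors, as the expected number of
words of level N whose interval breaks by time t (`exp_mul_sumLaw_ceil_le`, `le_exp_mul_sumLaw`).

In terms of u = √(2γs), the function h is the one for which N = h(t) means x = u - log u + const.
Shifting x by η gives A·`logMean` = x(log u - log x - η) + (u - x)²/2 (`mul_logMean_eq`), which is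
-ηu up to O(log² u). The shifts ±μ₂(log t)^{-1/3} correspond to η = ±d u^{-2/3} with d > 0, and d
u^{1/3} beats the error.

If η > 0, the mean is small and a union bound shows that no interval of level N has broken. If η <
0, the mean is large and a second moment argument gives a broken one
(`measureReal_forall_lt_lineSum_mul_le`); there the top half of the levels is treated separately,
since it takes little time but would correlate too many pairs. Both failure probabilities are
O(N^{-2}), so Borel-Cantelli over N applies, with one test time per level; monotonicity of the
events in time covers all other t (`ae_forall_lt_breakTime`, `ae_exists_breakTime_le`). -/

namespace RegularFragmentation

/-! ### Small-value bounds for sums of independent exponential times. -/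

open scoped ENNReal

/-- The law of a sum of `c` independent exponential variables with rates `r 0, …, r (c - 1)`. -/
noncomputable def sumLaw (r : ℕ → ℝ) : ℕ → Measure ℝ
  | 0 => Measure.dirac 0
  | c + 1 => (expMeasure (r c)).conv (sumLaw r c)

lemma isProbabilityMeasure_sumLaw {r : ℕ → ℝ} (hr : ∀ i, 0 < r i) (c : ℕ) :
    IsProbabilityMeasure (sumLaw r c) := by
  induction c with
  | zero => exact inferInstanceAs (IsProbabilityMeasure (Measure.dirac 0))
  | succ c ih =>
    have := isProbabilityMeasure_expMeasure (hr c)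
    exact inferInstanceAs (IsProbabilityMeasure ((expMeasure (r c)).conv (sumLaw r c)))

lemma lintegral_expMeasure {r : ℝ} {f : ℝ → ℝ≥0∞} (hf : Measurable f) :
    ∫⁻ x, f x ∂(expMeasure r) = ∫⁻ x, exponentialPDF r x * f x := by
  have hm : Measurable (exponentialPDF r) := (measurable_exponentialPDFReal r).ennreal_ofReal
  exact lintegral_withDensity_eq_lintegral_mul _ hm hf

lemma expMeasure_Iic {r : ℝ} (hr : 0 < r) {x : ℝ} (hx : 0 ≤ x) :
    expMeasure r (Set.Iic x) = ENNReal.ofReal (1 - Real.exp (-(r * x))) := by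
  have := isProbabilityMeasure_expMeasure hr
  rw [← ofReal_cdf, cdf_expMeasure_eq hr, if_pos hx]

lemma expMeasure_Ioi {r : ℝ} (hr : 0 < r) {x : ℝ} (hx : 0 ≤ x) :
    expMeasure r (Set.Ioi x) = ENNReal.ofReal (Real.exp (-(r * x))) := by
  have := isProbabilityMeasure_expMeasure hr
  rw [← Set.compl_Iic, prob_compl_eq_one_sub measurableSet_Iic, expMeasure_Iic hr hx,
    ← ENNReal.ofReal_one, ← ENNReal.ofReal_sub]
  · congr 1; ring
  · have : Real.exp (-(r * x)) ≤ 1 := Real.exp_le_one_iff.2 (by nlinarith [mul_nonneg hr.le hx])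
    linarith

lemma measurable_measure_Iic (μ : Measure ℝ) (t : ℝ) :
    Measurable fun x => μ (Set.Iic (t - x)) := by
  have : Antitone fun x => μ (Set.Iic (t - x)) := fun x y hxy =>
    measure_mono (Set.Iic_subset_Iic.2 (by linarith))
  exact this.measurable

lemma sumLaw_succ_Iic {r : ℕ → ℝ} (hr : ∀ i, 0 < r i) (c : ℕ) (t : ℝ) :
    sumLaw r (c + 1) (Set.Iic t)
      = ∫⁻ x, exponentialPDF (r c) x * sumLaw r c (Set.Iic (t - x)) := by
  have := isProbabilityMeasure_sumLaw hr c
  have hm : Measurable ((Set.Iic t).indicator (1 : ℝ → ℝ≥0∞)) :=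
    measurable_one.indicator measurableSet_Iic
  rw [← lintegral_expMeasure (measurable_measure_Iic _ _), sumLaw,
    ← lintegral_indicator_one measurableSet_Iic, Measure.lintegral_conv hm]
  refine lintegral_congr fun x => ?_
  rw [← lintegral_indicator_one measurableSet_Iic]
  refine lintegral_congr fun y => ?_
  have : x + y ≤ t ↔ y ≤ t - x := by constructor <;> intro <;> linarith
  simp only [Set.indicator, Set.mem_Iic, this]
  rfl

lemma setLIntegral_sub_pow (K t : ℝ) (hK : 0 ≤ K) (ht : 0 ≤ t) (c : ℕ) :
    ∫⁻ x in Set.Icc 0 t, ENNReal.ofReal (K * (t - x) ^ c)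
      = ENNReal.ofReal (K * (t ^ (c + 1) / (c + 1))) := by
  have hc : Continuous fun x : ℝ => K * (t - x) ^ c := by fun_prop
  rw [← ofReal_integral_eq_lintegral_ofReal]
  · congr 1
    rw [integral_Icc_eq_integral_Ioc, ← intervalIntegral.integral_of_le ht,
      intervalIntegral.integral_const_mul,
      intervalIntegral.integral_comp_sub_left (fun x => x ^ c) t]
    simp
  · exact hc.continuousOn.integrableOn_Icc
  · refine (ae_restrict_iff' measurableSet_Icc).2 (Filter.Eventually.of_forall fun x hx => ?_)
    have : 0 ≤ t - x := by linarith [hx.2]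
    simp only [Pi.zero_apply]; positivity

lemma sumLaw_Iic_of_neg {r : ℕ → ℝ} (hr : ∀ i, 0 < r i) (c : ℕ) {t : ℝ} (ht : t < 0) :
    sumLaw r c (Set.Iic t) = 0 := by
  induction c generalizing t with
  | zero => simp [sumLaw, ht]
  | succ c ih =>
    rw [sumLaw_succ_Iic hr, ← lintegral_zero (μ := (volume : Measure ℝ))]
    refine lintegral_congr fun x => ?_
    rcases lt_or_ge x 0 with hx | hx
    · rw [exponentialPDF_of_neg hx, zero_mul]
    · rw [ih (by linarith), mul_zero]

/-- The joint density is at most the product of the rates, and t^c/c! is the volume of the simplex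
of nonnegative times with sum at most t. -/
lemma sumLaw_Iic_le {r : ℕ → ℝ} (hr : ∀ i, 0 < r i) (c : ℕ) {t : ℝ} (ht : 0 ≤ t) :
    sumLaw r c (Set.Iic t)
      ≤ ENNReal.ofReal ((∏ i ∈ Finset.range c, r i) * (t ^ c / c.factorial)) := by
  induction c generalizing t with
  | zero =>
    have := isProbabilityMeasure_sumLaw hr 0
    simpa using prob_le_one (μ := sumLaw r 0) (s := Set.Iic t)
  | succ c ih =>
    have hP : 0 < ∏ i ∈ Finset.range c, r i := Finset.prod_pos fun i _ => hr i
    set K := r c * ((∏ i ∈ Finset.range c, r i) / c.factorial) with hKdef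
    have hK : 0 ≤ K := by have := hr c; positivity
    rw [sumLaw_succ_Iic hr]
    calc ∫⁻ x, exponentialPDF (r c) x * sumLaw r c (Set.Iic (t - x))
        ≤ ∫⁻ x in Set.Icc 0 t, ENNReal.ofReal (K * (t - x) ^ c) := by
          rw [← lintegral_indicator measurableSet_Icc]
          refine lintegral_mono fun x => ?_
          rcases lt_or_ge x 0 with hx | hx
          · rw [exponentialPDF_of_neg hx, zero_mul]; exact zero_le
          rcases lt_or_ge t x with hx' | hx'
          · rw [sumLaw_Iic_of_neg hr c (by linarith), mul_zero]; exact zero_le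
          rw [Set.indicator_of_mem (Set.mem_Icc.2 ⟨hx, hx'⟩), exponentialPDF_of_nonneg hx]
          refine (mul_le_mul' (ENNReal.ofReal_le_ofReal (q := r c) ?_) (ih (sub_nonneg.2 hx'))).trans ?_
          · have : Real.exp (-(r c * x)) ≤ 1 :=
              Real.exp_le_one_iff.2 (by nlinarith [mul_nonneg (hr c).le hx])
            nlinarith [hr c]
          · rw [← ENNReal.ofReal_mul (hr c).le]
            refine ENNReal.ofReal_le_ofReal (le_of_eq ?_)
            rw [hKdef]; ring
      _ = _ := by
          rw [setLIntegral_sub_pow K t hK ht]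
          congr 1
          rw [hKdef, Finset.prod_range_succ, Nat.factorial_succ]
          push_cast
          field_simp

/-- On the same simplex the exponential factors of the joint density multiply to at least e^{-bt},
since no rate exceeds b. -/
lemma le_sumLaw_Iic {r : ℕ → ℝ} (hr : ∀ i, 0 < r i) {b : ℝ} (hb0 : 0 ≤ b) (c : ℕ)
    (hb : ∀ i < c, r i ≤ b) {t : ℝ} (ht : 0 ≤ t) :
    ENNReal.ofReal (Real.exp (-(b * t)) * ((∏ i ∈ Finset.range c, r i) * (t ^ c / c.factorial)))
      ≤ sumLaw r c (Set.Iic t) := by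
  induction c generalizing t with
  | zero =>
    have h : Real.exp (-(b * t)) ≤ 1 :=
      Real.exp_le_one_iff.2 (by nlinarith [mul_nonneg hb0 ht])
    simpa [sumLaw, ht] using h
  | succ c ih =>
    have hP : 0 < ∏ i ∈ Finset.range c, r i := Finset.prod_pos fun i _ => hr i
    set K := Real.exp (-(b * t)) * (r c * ((∏ i ∈ Finset.range c, r i) / c.factorial)) with hKdef
    have hK : 0 ≤ K := by have := hr c; positivity
    rw [sumLaw_succ_Iic hr]
    calc _ = ∫⁻ x in Set.Icc 0 t, ENNReal.ofReal (K * (t - x) ^ c) := by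
          rw [setLIntegral_sub_pow K t hK ht]
          congr 1
          rw [hKdef, Finset.prod_range_succ, Nat.factorial_succ]
          push_cast
          field_simp
      _ ≤ ∫⁻ x, exponentialPDF (r c) x * sumLaw r c (Set.Iic (t - x)) := by
          rw [← lintegral_indicator measurableSet_Icc]
          refine lintegral_mono fun x => ?_
          refine Set.indicator_apply_le' (fun hx => ?_) (fun _ => zero_le)
          rw [exponentialPDF_of_nonneg hx.1]
          refine le_trans ?_ (mul_le_mul' le_rfl (ih (fun i hi => hb i (by omega))
            (sub_nonneg.2 hx.2)))
          rw [← ENNReal.ofReal_mul (by have := hr c; positivity)]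
          refine ENNReal.ofReal_le_ofReal ?_
          have h1 : Real.exp (-(b * t)) ≤ Real.exp (-(r c * x)) * Real.exp (-(b * (t - x))) := by
            rw [← Real.exp_add]
            refine Real.exp_le_exp.2 ?_
            nlinarith [mul_le_mul_of_nonneg_right (hb c (by omega)) hx.1]
          have h2 : 0 ≤ t - x := sub_nonneg.2 hx.2
          have h3 : 0 ≤ r c * ((∏ i ∈ Finset.range c, r i) / c.factorial) * (t - x) ^ c := by
            have := hr c; positivity
          rw [hKdef]
          calc _ = Real.exp (-(b * t)) *
                (r c * ((∏ i ∈ Finset.range c, r i) / c.factorial) * (t - x) ^ c) := by ring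
            _ ≤ _ := mul_le_mul_of_nonneg_right h1 h3
            _ = _ := by ring

lemma sumLaw_Iic_antitone {r : ℕ → ℝ} (hr : ∀ i, 0 < r i) (t : ℝ) :
    Antitone fun c => sumLaw r c (Set.Iic t) := by
  refine antitone_nat_of_succ_le fun c => ?_
  rw [sumLaw_succ_Iic hr]
  calc ∫⁻ x, exponentialPDF (r c) x * sumLaw r c (Set.Iic (t - x))
      ≤ ∫⁻ x, exponentialPDF (r c) x * sumLaw r c (Set.Iic t) := by
        refine lintegral_mono fun x => ?_
        rcases lt_or_ge x 0 with hx | hx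
        · simp [exponentialPDF_of_neg hx]
        · exact mul_le_mul' le_rfl (measure_mono (Set.Iic_subset_Iic.2 (by linarith)))
    _ = sumLaw r c (Set.Iic t) := by
        have hm : Measurable (exponentialPDF (r c)) :=
          (measurable_exponentialPDFReal _).ennreal_ofReal
        rw [lintegral_mul_const _ hm,
          lintegral_exponentialPDF_eq_one (hr c), one_mul]

lemma mul_le_conv_Iic (μ ν : Measure ℝ) [SFinite μ] [SFinite ν] (s t : ℝ) :
    μ (Set.Iic s) * ν (Set.Iic t) ≤ (μ.conv ν) (Set.Iic (s + t)) := by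
  rw [← Measure.prod_prod, Measure.conv, Measure.map_apply (by fun_prop) measurableSet_Iic]
  refine measure_mono ?_
  rintro ⟨x, y⟩ ⟨hx, hy⟩
  exact add_le_add (Set.mem_Iic.1 hx) (Set.mem_Iic.1 hy)

/-- A time budget: it suffices that the first m times use at most t together and each of the q
others at most s. -/
lemma sumLaw_mul_prod_le {r : ℕ → ℝ} (hr : ∀ i, 0 < r i) (m q : ℕ) (t : ℝ) {s : ℝ} (hs : 0 ≤ s) :
    sumLaw r m (Set.Iic t) *
        ENNReal.ofReal (∏ i ∈ Finset.range q, (1 - Real.exp (-(r (m + i) * s))))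
      ≤ sumLaw r (m + q) (Set.Iic (t + q * s)) := by
  induction q with
  | zero => simp
  | succ q ih =>
    have := isProbabilityMeasure_sumLaw hr (m + q)
    have := isProbabilityMeasure_expMeasure (hr (m + q))
    have h := mul_le_conv_Iic (expMeasure (r (m + q))) (sumLaw r (m + q)) s (t + q * s)
    have h0 : ∀ i, 0 ≤ 1 - Real.exp (-(r (m + i) * s)) := fun i => sub_nonneg.2
      (Real.exp_le_one_iff.2 (by nlinarith [mul_nonneg (hr (m + i)).le hs]))
    rw [Finset.prod_range_succ, ENNReal.ofReal_mul (Finset.prod_nonneg fun i _ => h0 i),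
      ← expMeasure_Iic (hr _) hs, ← mul_assoc]
    calc _ ≤ sumLaw r (m + q) (Set.Iic (t + q * s)) * expMeasure (r (m + q)) (Set.Iic s) := by
          gcongr
      _ ≤ _ := by
          rw [mul_comm]
          refine h.trans (le_of_eq ?_)
          have : s + (t + q * s) = t + ((q + 1 : ℕ) : ℝ) * s := by push_cast; ring
          rw [this]
          rfl

end RegularFragmentation

/-! ### Ancestral lines, first and second moments. -/

namespace RegularFragmentation

open scoped ENNReal

/-- The waiting times along the last `m` levels of the ancestral line of `v`. -/
def lineSum {k : ℕ} (L : List (Fin k) → ℝ) (m : ℕ) (v : List (Fin k)) : ℝ :=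
  ∑ i ∈ Finset.range m, L (v.drop i)

lemma lineSum_length_succ {k : ℕ} (L : List (Fin k) → ℝ) (v : List (Fin k)) :
    lineSum L (v.length + 1) v = breakTime L v := by
  induction v with
  | nil => simp [lineSum, breakTime]
  | cons d v ih =>
    rw [lineSum, Finset.sum_range_succ', breakTime, ← ih, lineSum]
    simp

lemma lineSum_mono {k : ℕ} {L : List (Fin k) → ℝ} (hL : ∀ v, 0 ≤ L v) (v : List (Fin k)) :
    Monotone fun m => lineSum L m v := fun _ _ h =>
  Finset.sum_le_sum_of_subset_of_nonneg (Finset.range_mono h) fun _ _ _ => hL _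

lemma breakTime_eq_lineSum_add {k : ℕ} (L : List (Fin k) → ℝ) {v : List (Fin k)} {m : ℕ}
    (hm : m ≤ v.length) : breakTime L v = lineSum L m v + breakTime L (v.drop m) := by
  rw [← lineSum_length_succ, ← lineSum_length_succ, lineSum, lineSum, lineSum]
  have : v.length + 1 = m + ((v.drop m).length + 1) := by rw [List.length_drop]; omega
  rw [this, Finset.sum_range_add]
  simp [List.drop_drop]

lemma drop_injOn {β : Type*} {v : List β} {m : ℕ} (hm : m ≤ v.length + 1) :
    Set.InjOn (fun i => v.drop i) (Finset.range m) := by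
  intro i hi j hj hij
  have := congrArg List.length hij
  simp only [Finset.coe_range, Set.mem_Iio, List.length_drop] at hi hj this
  omega

/-- The words of length `N`. -/
def words (k N : ℕ) : Finset (List (Fin k)) :=
  (Finset.univ : Finset (Fin N → Fin k)).image List.ofFn

lemma mem_words {k N : ℕ} {v : List (Fin k)} : v ∈ words k N ↔ v.length = N := by
  simp only [words, Finset.mem_image, Finset.mem_univ, true_and]
  constructor
  · rintro ⟨f, rfl⟩; simp
  · rintro rfl; exact ⟨v.get, List.ofFn_get v⟩

lemma card_words (k N : ℕ) : (words k N).card = k ^ N := by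
  rw [words, Finset.card_image_of_injective _ List.ofFn_injective]
  simp

lemma card_filter_drop_le {k N c : ℕ} (hc : c ≤ N) (v : List (Fin k)) :
    ((words k N).filter fun w => v.drop c = w.drop c).card ≤ k ^ c := by
  rw [← card_words k c]
  refine (Finset.card_le_card (t := (words k c).image (· ++ v.drop c)) ?_).trans
    Finset.card_image_le
  intro w hw
  rw [Finset.mem_filter, mem_words] at hw
  refine Finset.mem_image.2 ⟨w.take c, ?_, ?_⟩
  · rw [mem_words, List.length_take]; omega
  · simp only [hw.2, List.take_append_drop]

variable {Ω : Type*} [MeasurableSpace Ω] {P : Measure Ω}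

lemma indepFun_sum_of_disjoint {ι : Type*} {X : ι → Ω → ℝ} (hX : ∀ i, Measurable (X i))
    (hind : iIndepFun X P) {S T : Finset ι} (hST : Disjoint S T) :
    IndepFun (fun ω => ∑ i ∈ S, X i ω) (fun ω => ∑ i ∈ T, X i ω) P := by
  have h := hind.indepFun_finset S T hST hX
  have hm : ∀ U : Finset ι, Measurable fun x : U → ℝ => ∑ i, x i := fun U =>
    Finset.measurable_sum _ fun i _ => measurable_pi_apply i
  have h2 := h.comp (hm S) (hm T)
  convert h2 using 1 <;> ext ω <;> exact (Finset.sum_coe_sort _ (fun i => X i ω)).symm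

variable {k : ℕ} {L : List (Fin k) → Ω → ℝ} {ρ : ℕ → ℝ}

lemma measurable_lineSum (hL : ∀ v, Measurable (L v)) (m : ℕ) (v : List (Fin k)) :
    Measurable fun ω => lineSum (fun w => L w ω) m v :=
  Finset.measurable_sum _ fun _ _ => hL _

/-- Suffixes of two words of equal length can coincide only after dropping the same number of
letters, so `hne` makes the two families of waiting times disjoint. -/
lemma indepFun_lineSum (hL : ∀ v, Measurable (L v)) (hind : iIndepFun L P)
    {v w : List (Fin k)} (hvw : v.length = w.length) {m c : ℕ} (hm : m ≤ v.length + 1)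
    (hc : c ≤ w.length + 1) (hne : ∀ i < c, v.drop i ≠ w.drop i) :
    IndepFun (fun ω => lineSum (fun u => L u ω) m v) (fun ω => lineSum (fun u => L u ω) c w) P := by
  have hd : Disjoint ((Finset.range m).image fun i => v.drop i)
      ((Finset.range c).image fun i => w.drop i) := by
    rw [Finset.disjoint_left]
    intro u hu hu'
    obtain ⟨i, hi, rfl⟩ := Finset.mem_image.1 hu
    obtain ⟨j, hj, hij⟩ := Finset.mem_image.1 hu'
    have h1 := congrArg List.length hij
    simp only [List.length_drop, Finset.mem_range] at hi hj h1
    obtain rfl : i = j := by omega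
    exact hne i hj hij.symm
  have h := indepFun_sum_of_disjoint hL hind hd
  simp_rw [Finset.sum_image (drop_injOn hm), Finset.sum_image (drop_injOn hc)] at h
  exact h

variable [IsProbabilityMeasure P]

/-- Chebyshev: where none of the events occurs, the count is 0 and its squared deviation is the
squared mean; the right side is the variance. -/
lemma measureReal_none_mul_sq_le {ι : Type*} (W : Finset ι) {A : ι → Set Ω}
    (hA : ∀ i, MeasurableSet (A i)) :
    P.real {ω | ∀ i ∈ W, ω ∉ A i} * (∑ i ∈ W, P.real (A i)) ^ 2
      ≤ (∑ i ∈ W, ∑ j ∈ W, P.real (A i ∩ A j)) - (∑ i ∈ W, P.real (A i)) ^ 2 := by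
  classical
  set μ := ∑ i ∈ W, P.real (A i) with hμ
  set f : ι → Ω → ℝ := fun i => (A i).indicator 1 with hf
  have hfint : ∀ i, Integrable (f i) P := fun i =>
    (integrable_const (1 : ℝ)).indicator (hA i)
  have hfi : ∀ i, ∫ ω, f i ω ∂P = P.real (A i) := fun i => integral_indicator_one (hA i)
  have hff : ∀ i j, (fun ω => f i ω * f j ω) = (A i ∩ A j).indicator 1 := by
    intro i j
    ext ω
    rw [Set.inter_indicator_one]; rfl
  have hffint : ∀ i j, Integrable (fun ω => f i ω * f j ω) P := fun i j => by
    rw [hff]; exact (integrable_const (1 : ℝ)).indicator ((hA i).inter (hA j))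
  have hffi : ∀ i j, ∫ ω, f i ω * f j ω ∂P = P.real (A i ∩ A j) := fun i j => by
    rw [hff]; exact integral_indicator_one ((hA i).inter (hA j))
  have hexp : ∀ ω, (∑ i ∈ W, f i ω - μ) ^ 2
      = ∑ i ∈ W, ∑ j ∈ W, f i ω * f j ω - 2 * μ * ∑ i ∈ W, f i ω + μ ^ 2 := by
    intro ω
    rw [← Finset.sum_mul_sum]; ring
  have hS2 : Integrable (fun ω => ∑ i ∈ W, ∑ j ∈ W, f i ω * f j ω) P :=
    integrable_finsetSum _ fun i _ => integrable_finsetSum _ fun j _ => hffint i j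
  have hS1 : Integrable (fun ω => 2 * μ * ∑ i ∈ W, f i ω) P :=
    (integrable_finsetSum _ fun i _ => hfint i).const_mul _
  have hint : ∫ ω, (∑ i ∈ W, f i ω - μ) ^ 2 ∂P
      = (∑ i ∈ W, ∑ j ∈ W, P.real (A i ∩ A j)) - μ ^ 2 := by
    simp_rw [hexp]
    have e1 := integral_add (hS2.sub hS1) (integrable_const (μ := P) (μ ^ 2))
    have e2 := integral_sub hS2 hS1
    simp only [Pi.sub_apply] at e1
    rw [e1, e2, integral_const_mul, integral_finsetSum _ fun i _ => hfint i,
      integral_finsetSum _ fun i _ => integrable_finsetSum _ fun j _ => hffint i j]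
    simp_rw [integral_finsetSum W fun j _ => hffint _ j, hffi, hfi]
    simp only [integral_const, probReal_univ, one_smul]
    rw [← hμ]; ring
  have hN : MeasurableSet {ω | ∀ i ∈ W, ω ∉ A i} := by
    have : {ω | ∀ i ∈ W, ω ∉ A i} = ⋂ i ∈ W, (A i)ᶜ := by ext; simp
    rw [this]
    exact Finset.measurableSet_biInter _ fun i _ => (hA i).compl
  rw [← hint, ← integral_indicator_one hN, ← integral_mul_const]
  refine integral_mono (((integrable_const (1 : ℝ)).indicator hN).mul_const _) ?_ fun ω => ?_
  · simp_rw [hexp]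
    exact (hS2.sub hS1).add (integrable_const _)
  · by_cases hω : ω ∈ {ω | ∀ i ∈ W, ω ∉ A i}
    · have : ∑ i ∈ W, f i ω = 0 :=
        Finset.sum_eq_zero fun i hi => Set.indicator_of_notMem (hω i hi) _
      simp [this, Set.indicator_of_mem hω]
    · simp only [Set.indicator_of_notMem hω, zero_mul]
      positivity

lemma hasLaw_lineSum (hL : ∀ v, Measurable (L v)) (hind : iIndepFun L P)
    (hρ : ∀ i, 0 < ρ i)
    (hlaw : ∀ v, HasLaw (L v) (expMeasure (ρ v.length)) P) (v : List (Fin k)) {m : ℕ}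
    (hm : m ≤ v.length + 1) :
    HasLaw (fun ω => lineSum (fun u => L u ω) m v) (sumLaw (fun i => ρ (v.length - i)) m) P := by
  induction m with
  | zero =>
    simp only [lineSum, Finset.range_zero, Finset.sum_empty, sumLaw]
    exact hasLaw_dirac_of_ae_eq (Filter.EventuallyEq.refl _ _)
  | succ m ih =>
    have hd : Disjoint ({v.drop m} : Finset (List (Fin k)))
        ((Finset.range m).image fun i => v.drop i) := by
      rw [Finset.disjoint_singleton_left]
      intro h
      obtain ⟨i, hi, h⟩ := Finset.mem_image.1 h
      have h1 := congrArg List.length h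
      simp only [List.length_drop, Finset.mem_range] at hi h1
      omega
    have h := indepFun_sum_of_disjoint hL hind hd
    simp_rw [Finset.sum_image (drop_injOn (show m ≤ v.length + 1 by omega)),
      Finset.sum_singleton] at h
    have hl := hlaw (v.drop m)
    rw [List.length_drop] at hl
    have : IsProbabilityMeasure (expMeasure (ρ (v.length - m))) :=
      isProbabilityMeasure_expMeasure (hρ _)
    have : IsProbabilityMeasure (sumLaw (fun i => ρ (v.length - i)) m) :=
      isProbabilityMeasure_sumLaw (fun _ => hρ _) m
    have h2 := h.hasLaw_fun_add hl (ih (by omega))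
    simp only [sumLaw]
    convert h2 using 2 with ω
    rw [lineSum, Finset.sum_range_succ, add_comm]
    rfl

lemma measureReal_lineSum_le (hL : ∀ v, Measurable (L v)) (hind : iIndepFun L P)
    (hρ : ∀ i, 0 < ρ i)
    (hlaw : ∀ v, HasLaw (L v) (expMeasure (ρ v.length)) P) (v : List (Fin k)) {m : ℕ}
    (hm : m ≤ v.length + 1) (t : ℝ) :
    P.real {ω | lineSum (fun u => L u ω) m v ≤ t}
      = (sumLaw (fun i => ρ (v.length - i)) m).real (Set.Iic t) :=
  (hasLaw_lineSum hL hind hρ hlaw v hm).measureReal_eq (p := (· ≤ t)) measurableSet_Iic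

lemma measureReal_exists_breakTime_le (hL : ∀ v, Measurable (L v)) (hind : iIndepFun L P)
    (hρ : ∀ i, 0 < ρ i)
    (hlaw : ∀ v, HasLaw (L v) (expMeasure (ρ v.length)) P) (N : ℕ) (t : ℝ) :
    P.real {ω | ∃ v : List (Fin k), v.length = N ∧ breakTime (fun w => L w ω) v ≤ t}
      ≤ k ^ N * (sumLaw (fun i => ρ (N - i)) (N + 1)).real (Set.Iic t) := by
  have h : {ω | ∃ v : List (Fin k), v.length = N ∧ breakTime (fun w => L w ω) v ≤ t}
      = ⋃ v ∈ words k N, {ω | lineSum (fun w => L w ω) (N + 1) v ≤ t} := by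
    ext ω
    simp only [Set.mem_iUnion, mem_words, exists_prop, Set.mem_ofPred_eq]
    refine exists_congr fun v => and_congr_right fun hv => ?_
    rw [← lineSum_length_succ, hv]
  rw [h]
  refine (measureReal_biUnion_finset_le _ _).trans ?_
  rw [Finset.sum_congr rfl (g := fun _ => (sumLaw (fun i => ρ (N - i)) (N + 1)).real (Set.Iic t))]
  · simp [card_words]
  · intro v hv
    rw [mem_words] at hv
    subst hv
    exact measureReal_lineSum_le hL hind hρ hlaw v le_rfl t

/-- If the lines of v and w first meet c levels up, discarding the shared part of w's line only
enlarges the event, because waiting times are nonnegative; what remains is independent of v's line.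
The sum over c merely avoids naming the meeting level. -/
lemma measureReal_lineSum_inter_le (hL : ∀ v, Measurable (L v)) (hL0 : ∀ v ω, 0 ≤ L v ω) (hind : iIndepFun L P)
    (hρ : ∀ i, 0 < ρ i)
    (hlaw : ∀ v, HasLaw (L v) (expMeasure (ρ v.length)) P) {N m : ℕ}
    (hm : m ≤ N + 1) (t : ℝ) {v w : List (Fin k)} (hv : v.length = N) (hw : w.length = N) :
    P.real ({ω | lineSum (fun u => L u ω) m v ≤ t} ∩ {ω | lineSum (fun u => L u ω) m w ≤ t})
      ≤ (sumLaw (fun i => ρ (N - i)) m).real (Set.Iic t) ^ 2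
        + ∑ c ∈ Finset.range m, if v.drop c = w.drop c then
          (sumLaw (fun i => ρ (N - i)) m).real (Set.Iic t)
            * (sumLaw (fun i => ρ (N - i)) c).real (Set.Iic t) else 0 := by
  set p := fun c => (sumLaw (fun i => ρ (N - i)) c).real (Set.Iic t) with hp
  have hp0 : ∀ c, 0 ≤ p c := fun c => measureReal_nonneg
  have key : ∀ c ≤ m, (∀ i < c, v.drop i ≠ w.drop i) →
      P.real ({ω | lineSum (fun u => L u ω) m v ≤ t} ∩ {ω | lineSum (fun u => L u ω) c w ≤ t})
        = p m * p c := by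
    intro c hc hne
    have h1 := (indepFun_lineSum hL hind (hv.trans hw.symm) (m := m) (c := c) (by omega)
      (by omega) hne).measure_inter_preimage_eq_mul _ _
        (measurableSet_Iic (a := t)) (measurableSet_Iic (a := t))
    have h2 := measureReal_lineSum_le hL hind hρ hlaw v (m := m) (by omega) t
    have h3 := measureReal_lineSum_le hL hind hρ hlaw w (m := c) (by omega) t
    rw [hv] at h2
    rw [hw] at h3
    simp only [hp]
    rw [← h2, ← h3]
    simp only [measureReal_def, ← ENNReal.toReal_mul]
    exact congrArg _ h1
  by_cases hex : ∃ c < m, v.drop c = w.drop c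
  · classical
    have hex' : ∃ c, c < m ∧ v.drop c = w.drop c := hex
    obtain ⟨hcm, hceq⟩ := Nat.find_spec hex'
    set c := Nat.find hex' with hc
    have hne : ∀ i < c, v.drop i ≠ w.drop i := fun i hi h =>
      Nat.find_min hex' hi ⟨hi.trans hcm, h⟩
    calc _ ≤ P.real ({ω | lineSum (fun u => L u ω) m v ≤ t}
          ∩ {ω | lineSum (fun u => L u ω) c w ≤ t}) := by
          refine measureReal_mono (Set.inter_subset_inter_right _ fun ω hω => ?_)
          exact (lineSum_mono (fun u => hL0 u ω) w hcm.le).trans hω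
      _ = p m * p c := key c hcm.le hne
      _ = if v.drop c = w.drop c then p m * p c else 0 := (if_pos hceq).symm
      _ ≤ ∑ c ∈ Finset.range m, if v.drop c = w.drop c then p m * p c else 0 :=
          Finset.single_le_sum (f := fun c => if v.drop c = w.drop c then p m * p c else 0)
            (fun i _ => by
              split_ifs
              · exact mul_nonneg (hp0 _) (hp0 _)
              · exact le_rfl) (Finset.mem_range.2 hcm)
      _ ≤ _ := le_add_of_nonneg_left (sq_nonneg _)
  · push Not at hex
    rw [key m le_rfl hex, ← sq]
    refine le_add_of_nonneg_right (Finset.sum_nonneg fun c _ => ?_)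
    split_ifs
    · exact mul_nonneg (hp0 _) (hp0 _)
    · exact le_rfl

/-- In the variance the independent part cancels the squared mean. For each of the k^N words at most
k^c words share its ancestor c levels up, which leaves the mean times ∑ k^c p_c. -/
lemma measureReal_forall_lt_lineSum_mul_le (hk : 0 < k) (hL : ∀ v, Measurable (L v))
    (hL0 : ∀ v ω, 0 ≤ L v ω) (hind : iIndepFun L P) (hρ : ∀ i, 0 < ρ i)
    (hlaw : ∀ v, HasLaw (L v) (expMeasure (ρ v.length)) P) {N m : ℕ} (hm : m ≤ N + 1) (t : ℝ) :
    P.real {ω | ∀ v : List (Fin k), v.length = N → t < lineSum (fun w => L w ω) m v}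
        * (k ^ N * (sumLaw (fun i => ρ (N - i)) m).real (Set.Iic t))
      ≤ ∑ c ∈ Finset.range m, k ^ c * (sumLaw (fun i => ρ (N - i)) c).real (Set.Iic t) := by
  set p := fun c => (sumLaw (fun i => ρ (N - i)) c).real (Set.Iic t) with hp
  have hp0 : ∀ c, 0 ≤ p c := fun c => measureReal_nonneg
  have hkN : (0 : ℝ) < (k : ℝ) ^ N := by positivity
  set A : List (Fin k) → Set Ω := fun v => {ω | lineSum (fun w => L w ω) m v ≤ t} with hA
  have hset : {ω | ∀ v : List (Fin k), v.length = N → t < lineSum (fun w => L w ω) m v}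
      = {ω | ∀ v ∈ words k N, ω ∉ A v} := by
    ext ω
    simp [mem_words, hA]
  have hsum : ∑ v ∈ words k N, P.real (A v) = k ^ N * p m := by
    rw [Finset.sum_congr rfl (g := fun _ => p m)]
    · simp [card_words]
    · intro v hv
      rw [mem_words] at hv
      subst hv
      exact measureReal_lineSum_le hL hind hρ hlaw v hm t
  have hpairs : ∑ v ∈ words k N, ∑ w ∈ words k N, P.real (A v ∩ A w)
      ≤ (k ^ N * p m) ^ 2 + k ^ N * p m * ∑ c ∈ Finset.range m, k ^ c * p c := by
    calc _ ≤ ∑ v ∈ words k N, ∑ w ∈ words k N,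
          (p m ^ 2 + ∑ c ∈ Finset.range m, if v.drop c = w.drop c then p m * p c else 0) :=
          Finset.sum_le_sum fun v hv => Finset.sum_le_sum fun w hw =>
            measureReal_lineSum_inter_le hL hL0 hind hρ hlaw hm t (mem_words.1 hv) (mem_words.1 hw)
      _ = ∑ v ∈ words k N, (k ^ N * p m ^ 2 + ∑ c ∈ Finset.range m,
            (((words k N).filter fun w => v.drop c = w.drop c).card : ℝ) * (p m * p c)) := by
          refine Finset.sum_congr rfl fun v _ => ?_
          rw [Finset.sum_add_distrib, Finset.sum_comm]
          simp only [Finset.sum_const, card_words, nsmul_eq_mul, ← Finset.sum_filter]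
          push_cast; rfl
      _ ≤ ∑ v ∈ words k N, (k ^ N * p m ^ 2 + ∑ c ∈ Finset.range m,
            (k : ℝ) ^ c * (p m * p c)) := by
          refine Finset.sum_le_sum fun v _ => add_le_add le_rfl (Finset.sum_le_sum fun c hc => ?_)
          refine mul_le_mul_of_nonneg_right ?_ (mul_nonneg (hp0 _) (hp0 _))
          have := Finset.mem_range.1 hc
          exact_mod_cast card_filter_drop_le (show c ≤ N by omega) v
      _ = _ := by
          rw [Finset.sum_const, card_words, nsmul_eq_mul, Finset.mul_sum, mul_add,
            Finset.mul_sum]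
          push_cast
          congr 1
          · ring
          · exact Finset.sum_congr rfl fun c _ => by ring
  rw [hset]
  have hA' : ∀ v, MeasurableSet (A v) := fun v =>
    measurableSet_le (measurable_lineSum hL m v) measurable_const
  have h := measureReal_none_mul_sq_le (P := P) (words k N) hA'
  rw [hsum] at h
  -- One factor k^N p_m has to be cancelled from Chebyshev's inequality, so p_m = 0 is separate.
  rcases (hp0 m).eq_or_lt with h0 | h0
  · have : k ^ N * p m = 0 := by rw [← h0, mul_zero]
    rw [this, mul_zero]
    exact Finset.sum_nonneg fun c _ => mul_nonneg (by positivity) (hp0 c)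
  · have hpos : 0 < k ^ N * p m := mul_pos hkN h0
    refine le_of_mul_le_mul_left ?_ hpos
    nlinarith

lemma measureReal_exists_breakTime_gt (hρ : ∀ i, 0 < ρ i)
    (hlaw : ∀ v, HasLaw (L v) (expMeasure (ρ v.length)) P) (l : ℕ) {b y : ℝ} (hy : 0 ≤ y)
    (hb : ∀ i ≤ l, b ≤ ρ i) :
    P.real {ω | ∃ v : List (Fin k), v.length = l ∧ (l + 1) * y < breakTime (fun w => L w ω) v}
      ≤ k ^ l * ((l + 1) * Real.exp (-(b * y))) := by
  have hsub : {ω | ∃ v : List (Fin k), v.length = l ∧ (l + 1) * y < breakTime (fun w => L w ω) v}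
      ⊆ ⋃ v ∈ words k l, ⋃ i ∈ Finset.range (l + 1), {ω | y < L (v.drop i) ω} := by
    rintro ω ⟨v, hv, h⟩
    simp only [Set.mem_iUnion, mem_words, exists_prop, Finset.mem_range, Set.mem_ofPred_eq]
    refine ⟨v, hv, ?_⟩
    by_contra! hcon
    rw [← lineSum_length_succ, lineSum, hv] at h
    have := Finset.sum_le_card_nsmul (Finset.range (l + 1)) (fun i => L (v.drop i) ω) y
      fun i hi => hcon i (Finset.mem_range.1 hi)
    rw [Finset.card_range, nsmul_eq_mul] at this
    push_cast at this
    linarith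
  refine (measureReal_mono hsub (measure_ne_top _ _)).trans ((measureReal_biUnion_finset_le _ _).trans ?_)
  have hle : ∀ v ∈ words k l, P.real (⋃ i ∈ Finset.range (l + 1), {ω | y < L (v.drop i) ω})
      ≤ (l + 1) * Real.exp (-(b * y)) := by
    intro v hv
    rw [mem_words] at hv
    refine (measureReal_biUnion_finset_le _ _).trans ?_
    refine (Finset.sum_le_card_nsmul _ _ (Real.exp (-(b * y))) fun i hi => ?_).trans_eq (by simp)
    have h1 := (hlaw (v.drop i)).measureReal_eq (p := fun x => y < x) measurableSet_Ioi
    rw [h1]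
    change (expMeasure _).real (Set.Ioi y) ≤ _
    rw [measureReal_def, expMeasure_Ioi (hρ _) hy, ENNReal.toReal_ofReal (Real.exp_pos _).le]
    refine Real.exp_le_exp.2 (neg_le_neg (mul_le_mul_of_nonneg_right (hb _ ?_) hy))
    rw [List.length_drop]; omega
  refine (Finset.sum_le_card_nsmul _ _ _ hle).trans_eq ?_
  rw [card_words, nsmul_eq_mul]; push_cast; rfl

/-- Levels 0, …, l are set aside: with high probability every line crosses them within (l + 1)y, so
the second moment is only needed for the N - l deepest levels. -/
lemma measureReal_forall_lt_breakTime_le (hρ : ∀ i, 0 < ρ i)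
    (hlaw : ∀ v, HasLaw (L v) (expMeasure (ρ v.length)) P) {N l : ℕ} (hl : l ≤ N) {b y : ℝ}
    (hy : 0 ≤ y) (hb : ∀ i ≤ l, b ≤ ρ i) (t : ℝ) :
    P.real {ω | ∀ v : List (Fin k), v.length = N → t < breakTime (fun w => L w ω) v}
      ≤ P.real {ω | ∀ v : List (Fin k), v.length = N →
            t - (l + 1) * y < lineSum (fun w => L w ω) (N - l) v}
        + k ^ l * ((l + 1) * Real.exp (-(b * y))) := by
  refine le_trans ?_ (add_le_add le_rfl (measureReal_exists_breakTime_gt hρ hlaw l hy hb))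
  refine (measureReal_mono ?_).trans (measureReal_union_le _ _)
  intro ω hω
  by_cases h : ∀ v : List (Fin k), v.length = N →
      t - (l + 1) * y < lineSum (fun w => L w ω) (N - l) v
  · exact Or.inl h
  · push Not at h
    obtain ⟨v, hv, h⟩ := h
    refine Or.inr ⟨v.drop (N - l), by rw [List.length_drop]; omega, ?_⟩
    have h1 := hω v hv
    rw [breakTime_eq_lineSum_add (m := N - l) _ (by omega)] at h1
    linarith

end RegularFragmentation

/-! ### Stirling estimates and the size of the mean. -/

namespace RegularFragmentation

/-- The derivative of y log y - y is log y, which lies in [0, log m] on [1, m]. This and the next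
bound let x/A replace the integer ⌈x/A⌉ in Stirling's formula. -/
lemma mul_log_sub_self_le {y m : ℝ} (hy : 1 ≤ y) (hym : y ≤ m) :
    y * Real.log y - y ≤ m * Real.log m - m := by
  have hy0 : 0 < y := by linarith
  have hm0 : 0 < m := by linarith
  have h := Real.add_one_le_exp (Real.log (y / m))
  rw [Real.exp_log (by positivity), Real.log_div hy0.ne' hm0.ne', le_div_iff₀ hm0] at h
  nlinarith [mul_nonneg (sub_nonneg.2 hym) (Real.log_nonneg hy), Real.log_nonneg hy]

lemma mul_log_sub_self_le_add {y m : ℝ} (hy : 1 ≤ y) (hym : y ≤ m) (hmy : m ≤ y + 1) :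
    m * Real.log m - m ≤ y * Real.log y - y + Real.log m := by
  have hy0 : 0 < y := by linarith
  have hm0 : 0 < m := by linarith
  have h := Real.add_one_le_exp (Real.log (m / y))
  rw [Real.exp_log (by positivity), Real.log_div hm0.ne' hy0.ne', le_div_iff₀ hy0] at h
  have : 0 ≤ Real.log m := Real.log_nonneg (hy.trans hym)
  nlinarith

lemma mul_log_sub_le_log_factorial {n : ℕ} (hn : n ≠ 0) :
    n * Real.log n - n ≤ Real.log n.factorial := by
  have h := Stirling.le_log_factorial_stirling hn
  have h1 : 0 ≤ Real.log n := Real.log_natCast_nonneg n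
  have h2 : 0 ≤ Real.log (2 * Real.pi) := Real.log_nonneg (by linarith [Real.pi_gt_three])
  linarith

lemma log_factorial_le {n : ℕ} (hn : n ≠ 0) :
    Real.log n.factorial ≤ n * Real.log n - n + Real.log n + 1 := by
  induction n with
  | zero => exact absurd rfl hn
  | succ n ih =>
    rcases Nat.eq_zero_or_pos n with rfl | hpos
    · simp
    have hn0 : (0 : ℝ) < n := by exact_mod_cast hpos
    have h := ih hpos.ne'
    rw [Nat.factorial_succ, Nat.cast_mul, Real.log_mul (by positivity) (by positivity)]
    push_cast
    have h1 : 1 - ((n + 1 : ℝ) / n)⁻¹ ≤ Real.log ((n + 1) / n) :=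
      Real.one_sub_inv_le_log_of_pos (by positivity)
    rw [Real.log_div (by positivity) hn0.ne', inv_div, one_sub_div (by positivity),
      div_le_iff₀ (by positivity)] at h1
    nlinarith

lemma prod_rate_mul_pow (A s : ℝ) {N c : ℕ} (hc : c ≤ N + 1) :
    (∏ i ∈ Finset.range c, Real.exp (-(A * ((N - i : ℕ) : ℝ)))) * Real.exp s ^ c
      = Real.exp (-(c * (N * A - s)) + A * (c * (c - 1)) / 2) := by
  induction c with
  | zero => simp
  | succ c ih =>
    have h : ((N - c : ℕ) : ℝ) = N - c := Nat.cast_sub (by omega)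
    rw [Finset.prod_range_succ, pow_succ, mul_mul_mul_comm, ih (by omega), h, ← Real.exp_add,
      ← Real.exp_add]
    congr 1
    push_cast
    ring

/-- The cost of the fast levels, from 1 - e^{-z} ≥ w/(w + 1) for 0 < w ≤ z. The first O(log n)
factors are at least 1/(5n²), giving e^{-O(log² n)}; the at most n others are at least n/(n + 1),
with product at least 1/e. -/
lemma exp_neg_le_prod {A : ℝ} (hA : 0 < A) {n q : ℕ} (hn : 0 < n) (hq : q ≤ n) {z : ℕ → ℝ}
    (hz : ∀ j < q, Real.exp (A * j) / (4 * (n : ℝ) ^ 2) ≤ z j) :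
    Real.exp (-(1 + ((3 * Real.log n + 2) / A + 1) * (2 * Real.log n + 2)))
      ≤ ∏ j ∈ Finset.range q, (1 - Real.exp (-z j)) := by
  have hn0 : (0 : ℝ) < n := by exact_mod_cast hn
  have hn1 : (1 : ℝ) ≤ n := by exact_mod_cast hn
  have hl : 0 ≤ Real.log n := Real.log_nonneg hn1
  have hlog4 : Real.log 4 ≤ 2 := by
    rw [Real.log_le_iff_le_exp (by norm_num)]
    have := Real.add_one_le_exp (1 : ℝ)
    calc (4 : ℝ) = 2 * 2 := by norm_num
      _ ≤ Real.exp 1 * Real.exp 1 := by gcongr <;> linarith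
      _ = Real.exp 2 := by rw [← Real.exp_add]; norm_num
  have hlog5 : Real.log 5 ≤ 2 := by
    rw [Real.log_le_iff_le_exp (by norm_num)]
    have := Real.exp_one_gt_d9
    calc (5 : ℝ) ≤ 2.7 * 2.7 := by norm_num
      _ ≤ Real.exp 1 * Real.exp 1 := by gcongr <;> linarith
      _ = Real.exp 2 := by rw [← Real.exp_add]; norm_num
  -- From j = J on, e^{Aj} ≥ e²n³ ≥ 4n³, hence z j ≥ n.
  set J : ℕ := ⌈(3 * Real.log n + 2) / A⌉₊ with hJ
  have hJ1 : (3 * Real.log n + 2) / A ≤ J := Nat.le_ceil _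
  have hJ2 : (J : ℝ) ≤ (3 * Real.log n + 2) / A + 1 := (Nat.ceil_lt_add_one (by positivity)).le
  set a : ℝ := 1 / (5 * (n : ℝ) ^ 2) with ha
  set b : ℝ := n / (n + 1) with hb
  have ha0 : 0 < a := by positivity
  have hb0 : 0 < b := by positivity
  have ha1 : a ≤ 1 := by rw [ha, div_le_one (by positivity)]; nlinarith
  have hb1 : b ≤ 1 := by rw [hb, div_le_one (by positivity)]; linarith
  have hbase : ∀ w z : ℝ, 0 < w → w ≤ z → w / (w + 1) ≤ 1 - Real.exp (-z) := by
    intro w z hw hwz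
    have h1 : Real.exp (-z) ≤ 1 / (w + 1) := by
      rw [Real.exp_neg, ← one_div]
      exact one_div_le_one_div_of_le (by linarith) ((by linarith [Real.add_one_le_exp z]))
    have : w / (w + 1) = 1 - 1 / (w + 1) := by field_simp; ring
    linarith
  have hfac : ∀ j ∈ Finset.range q, (if j < J then a else b) ≤ 1 - Real.exp (-z j) := by
    intro j hj
    have hzj := hz j (Finset.mem_range.1 hj)
    split_ifs with hjJ
    · refine le_trans ?_ (hbase (1 / (4 * (n : ℝ) ^ 2)) _ (by positivity) (le_trans ?_ hzj))
      · rw [ha, div_add_one (by positivity), div_div_div_cancel_right₀ (by positivity)]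
        exact one_div_le_one_div_of_le (by positivity) (by nlinarith)
      · gcongr
        exact Real.one_le_exp (by positivity)
    · refine hbase n _ hn0 (le_trans ?_ hzj)
      rw [le_div_iff₀ (by positivity)]
      have h1 : (J : ℝ) ≤ j := by exact_mod_cast not_lt.1 hjJ
      have h2 : 3 * Real.log n + 2 ≤ A * j := by
        rw [div_le_iff₀ hA] at hJ1
        nlinarith
      calc (n : ℝ) * (4 * n ^ 2) = Real.exp (Real.log (4 * n ^ 3)) := by
            rw [Real.exp_log (by positivity)]; ring
        _ ≤ _ := by
            refine Real.exp_le_exp.2 ?_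
            rw [Real.log_mul (by norm_num) (by positivity), Real.log_pow]
            push_cast; linarith
  refine le_trans ?_ (Finset.prod_le_prod (fun j _ => by split_ifs <;> positivity) hfac)
  rw [Finset.prod_ite, Finset.prod_const, Finset.prod_const]
  have hc1 : ((Finset.range q).filter fun j => j < J).card ≤ J := by
    refine (Finset.card_le_card (t := Finset.range J) fun j hj => ?_).trans_eq
      (Finset.card_range _)
    exact Finset.mem_range.2 (Finset.mem_filter.1 hj).2
  have hc2 : ((Finset.range q).filter fun j => ¬ j < J).card ≤ n :=
    (Finset.card_filter_le _ _).trans (by simpa using hq)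
  have ha' : Real.exp (-((J : ℝ) * (2 * Real.log n + 2))) ≤ a ^ J := by
    rw [← mul_neg, Real.exp_nat_mul]
    refine pow_le_pow_left₀ (Real.exp_pos _).le ?_ _
    rw [ha, one_div, Real.exp_neg]
    refine inv_anti₀ (by positivity) ?_
    rw [← Real.log_le_iff_le_exp (by positivity), Real.log_mul (by norm_num) (by positivity),
      Real.log_pow]
    push_cast; linarith
  have hb' : Real.exp (-1) ≤ b ^ n := by
    have h1 : Real.exp (-(1 / (n : ℝ))) ≤ b := by
      rw [Real.exp_neg, hb, ← inv_div (n + 1 : ℝ) n]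
      refine inv_anti₀ (by positivity) ?_
      have := Real.add_one_le_exp (1 / (n : ℝ))
      rwa [add_div, div_self hn0.ne', add_comm]
    calc Real.exp (-1) = Real.exp (-(1 / (n : ℝ))) ^ n := by
          rw [← Real.exp_nat_mul]; congr 1; field_simp
      _ ≤ b ^ n := pow_le_pow_left₀ (Real.exp_pos _).le h1 _
  calc Real.exp (-(1 + ((3 * Real.log n + 2) / A + 1) * (2 * Real.log n + 2)))
      ≤ Real.exp (-((J : ℝ) * (2 * Real.log n + 2))) * Real.exp (-1) := by
        rw [← Real.exp_add]
        refine Real.exp_le_exp.2 ?_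
        nlinarith [mul_le_mul_of_nonneg_right hJ2 (show 0 ≤ 2 * Real.log n + 2 by linarith)]
    _ ≤ a ^ J * b ^ n := mul_le_mul ha' hb' (Real.exp_pos _).le (by positivity)
    _ ≤ _ := mul_le_mul (pow_le_pow_of_le_one ha0.le ha1 hc1)
        (pow_le_pow_of_le_one hb0.le hb1 hc2) (by positivity) (by positivity)

/-- The logarithm, up to lower order terms, of the expected number of the words of length `N`
whose interval breaks before time `exp (N * A - x)`. -/
noncomputable def logMean (A g N x : ℝ) : ℝ :=
  g * N - x ^ 2 / (2 * A) - x / 2 - (x / A * Real.log (x / A) - x / A)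

/-- An error term of the order `(log n) ^ 2`. -/
noncomputable def logErr (A n : ℝ) : ℝ :=
  A / 2 + 4 + 2 * Real.log n + ((3 * Real.log n + 2) / A + 1) * (2 * Real.log n + 2)

/-- The rate at which the intervals of level `N - i` break, where `A = α log k`. -/
noncomputable def rate (A : ℝ) (i : ℕ) : ℝ := Real.exp (-(A * i))

lemma rate_pos (A : ℝ) (i : ℕ) : 0 < rate A i := Real.exp_pos _

section

variable {A g s x : ℝ} {N : ℕ}

lemma sumLaw_real_le {c : ℕ} (hc : c ≤ N + 1) :
    (sumLaw (fun i => rate A (N - i)) c).real (Set.Iic (Real.exp s))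
      ≤ Real.exp (-(c * (N * A - s)) + A * (c * (c - 1)) / 2) / c.factorial := by
  have h := sumLaw_Iic_le (r := fun i => rate A (N - i)) (fun _ => rate_pos _ _) c
    (Real.exp_pos s).le
  refine ENNReal.toReal_le_of_le_ofReal (by positivity) (h.trans_eq ?_)
  rw [← mul_div_assoc, ← prod_rate_mul_pow A s hc]
  rfl

/-- The exponent is at most -c(x - g - A(c - 1)/2), and both g and A(c - 1)/2 are at most x/2. This
controls the near relatives in the second moment. -/
lemma exp_mul_sumLaw_real_le_one (hx : x = N * A - s) (hg : 2 * g ≤ x) {c : ℕ}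
    (hc : c ≤ N + 1) (hcx : A * (c - 1) ≤ x) :
    Real.exp (g * c) * (sumLaw (fun i => rate A (N - i)) c).real (Set.Iic (Real.exp s)) ≤ 1 := by
  have h := sumLaw_real_le (A := A) (s := s) hc
  have hf : (1 : ℝ) ≤ c.factorial := by exact_mod_cast c.factorial_pos
  have h2 := h.trans (div_le_self (Real.exp_pos _).le hf)
  refine (mul_le_mul_of_nonneg_left h2 (Real.exp_pos _).le).trans ?_
  rw [← Real.exp_add, Real.exp_le_one_iff, ← hx]
  have hc0 : (0 : ℝ) ≤ c := c.cast_nonneg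
  nlinarith [mul_nonneg hc0 (show 0 ≤ x - g - A * (c - 1) / 2 by linarith)]

lemma ceil_div_bounds (hA : 0 < A) (hy : A ≤ x) :
    x ≤ A * (⌈x / A⌉₊ : ℝ) ∧ A * ((⌈x / A⌉₊ : ℝ) - 1) ≤ x := by
  have h1 := Nat.le_ceil (x / A)
  have h2 := (Nat.ceil_lt_add_one (div_nonneg (hA.le.trans hy) hA.le)).le
  rw [div_le_iff₀ hA] at h1
  rw [← sub_le_iff_le_add, le_div_iff₀ hA] at h2
  constructor <;> linarith

/-- The ⌈x/A⌉ deepest levels are those whose rate is below e^{-s}; keeping exactly these makes the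
simplex bound nearly optimal. -/
lemma exp_mul_sumLaw_ceil_le (hA : 0 < A) (hx : x = N * A - s) (hy : A ≤ x) (hyN : x ≤ N * A) :
    Real.exp (g * N) *
        (sumLaw (fun i => rate A (N - i)) ⌈x / A⌉₊).real (Set.Iic (Real.exp s))
      ≤ Real.exp (logMean A g N x + A / 2) := by
  obtain ⟨h1, h2⟩ := ceil_div_bounds hA hy
  set m := ⌈x / A⌉₊ with hm
  have hm0 : m ≠ 0 := (Nat.ceil_pos.2 (div_pos (by linarith) hA)).ne'
  have hmN : m ≤ N + 1 := by
    refine Nat.ceil_le.2 ?_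
    rw [div_le_iff₀ hA]; push_cast; nlinarith
  refine (mul_le_mul_of_nonneg_left (sumLaw_real_le hmN) (Real.exp_pos _).le).trans ?_
  have hf : (0 : ℝ) < m.factorial := by exact_mod_cast m.factorial_pos
  rw [← Real.exp_log hf, ← Real.exp_sub, ← Real.exp_add, ← hx]
  refine Real.exp_le_exp.2 ?_
  have h3 := mul_log_sub_le_log_factorial hm0
  have h4 := mul_log_sub_self_le (y := x / A) (m := m) (by rwa [le_div_iff₀ hA, one_mul])
    (Nat.le_ceil _)
  -- Completing the square around m = x/A; rounding up gives 0 ≤ Am - x ≤ A.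
  have h5 : -(m * x) + A * (m * (m - 1)) / 2
      ≤ A / 2 - x ^ 2 / (2 * A) - x / 2 := by
    have : A / 2 - x ^ 2 / (2 * A) - x / 2 - (-(m * x) + A * (m * (m - 1)) / 2)
        = (A ^ 2 - (A * m - x) ^ 2 + A * (A * m - x)) / (2 * A) := by field_simp; ring
    have h6 : 0 ≤ (A ^ 2 - (A * m - x) ^ 2 + A * (A * m - x)) / (2 * A) :=
      div_nonneg (by nlinarith) (by positivity)
    linarith
  rw [logMean]
  linarith

/-- With n = N + 1 and t = e^s, the slow levels get t(1 - 1/(2n)), the fast ones t/(4n²) each, so at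
most t/(4n) together, and the last t/(4n) is reserved for the separate treatment of the top levels.
-/
lemma le_exp_mul_sumLaw (hA : 0 < A) (hx : x = N * A - s) (hy : A ≤ x) (hyN : x ≤ N * A) :
    Real.exp (logMean A g N x - logErr A (N + 1)) ≤ Real.exp (g * N) *
        (sumLaw (fun i => rate A (N - i)) (N + 1)).real
          (Set.Iic (Real.exp s - Real.exp s / (4 * (N + 1)))) := by
  obtain ⟨h1, h2⟩ := ceil_div_bounds hA hy
  set m := ⌈x / A⌉₊ with hm
  have hm0 : m ≠ 0 := (Nat.ceil_pos.2 (div_pos (by linarith) hA)).ne'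
  have hmN : m ≤ N + 1 := by
    refine Nat.ceil_le.2 ?_
    rw [div_le_iff₀ hA]; push_cast; nlinarith
  have hmN' : (m : ℝ) ≤ N + 1 := by exact_mod_cast hmN
  have hm1 : (1 : ℝ) ≤ m := by exact_mod_cast Nat.one_le_iff_ne_zero.2 hm0
  set n : ℝ := N + 1 with hn
  have hn0 : 0 < n := by positivity
  have hn1 : 1 ≤ n := by linarith
  set t := Real.exp s with ht
  have ht0 : 0 < t := Real.exp_pos s
  set r := fun i => rate A (N - i) with hr
  have hr0 : ∀ i, 0 < r i := fun _ => rate_pos _ _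
  set q := N + 1 - m with hq
  have hqn : (q : ℝ) ≤ n := by rw [hn]; exact_mod_cast (show q ≤ N + 1 by omega)
  set z := t / (4 * n ^ 2) with hz
  have hz0 : 0 < z := by positivity
  set t' := t * (1 - 1 / (2 * n)) with ht'
  have hinv : 1 / (2 * n) ≤ 1 / 2 := one_div_le_one_div_of_le (by norm_num) (by linarith)
  have ht'0 : 0 < t' := mul_pos ht0 (by linarith)
  have ht'le : t' ≤ t :=
    mul_le_of_le_one_right ht0.le (by linarith [show 0 ≤ 1 / (2 * n) by positivity])
  have hle : t' ≤ t - t / (4 * n) - q * z := by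
    have h3 : (q : ℝ) * z ≤ n * z := mul_le_mul_of_nonneg_right hqn hz0.le
    have h4 : n * z = t / (4 * n) := by rw [hz]; field_simp
    have h5 : t' = t - t / (4 * n) - t / (4 * n) := by rw [ht']; field_simp; ring
    linarith
  have hmq : m + q = N + 1 := by omega
  have hsplit := sumLaw_mul_prod_le hr0 m q (t - t / (4 * n) - q * z) hz0.le
  rw [sub_add_cancel, hmq] at hsplit
  have hrate : ∀ i ≤ N, r i = Real.exp (-(A * (N - i))) := fun i hi => by
    simp only [hr, rate]; rw [Nat.cast_sub hi]
  have hprod : Real.exp (-(1 + ((3 * Real.log n + 2) / A + 1) * (2 * Real.log n + 2)))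
      ≤ ∏ i ∈ Finset.range q, (1 - Real.exp (-(r (m + i) * z))) := by
    have h3 := exp_neg_le_prod hA (n := N + 1) (q := q) (z := fun i => r (m + i) * z)
      (by omega) (by omega) (fun j hj => ?_)
    · push_cast at h3; exact h3
    · rw [hrate _ (by omega), hz, ← mul_div_assoc, ht, ← Real.exp_add]
      push_cast
      gcongr
      nlinarith
  have hlow : Real.exp (-1) / 2 * (Real.exp (-(m * x) + A * (m * (m - 1)) / 2) / m.factorial)
      ≤ (sumLaw r m).real (Set.Iic (t - t / (4 * n) - q * z)) := by
    have h3 := le_sumLaw_Iic hr0 (hr0 (m - 1)).le m (fun i hi => ?_) ht'0.le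
    · have := isProbabilityMeasure_sumLaw hr0 m
      refine le_trans ?_ (measureReal_mono (Set.Iic_subset_Iic.2 hle))
      refine le_trans ?_ ((ENNReal.ofReal_le_iff_le_toReal (measure_ne_top _ _)).1 h3)
      rw [hx, ← prod_rate_mul_pow A s hmN, ht', mul_pow]
      -- Even the fastest of the m slow levels has rate at most 1/t, so the damping factor is at
      -- least 1/e.
      have hb : r (m - 1) * t' ≤ 1 := by
        refine (mul_le_mul_of_nonneg_left ht'le (hr0 _).le).trans ?_
        rw [hrate _ (by omega), ht, ← Real.exp_add, Real.exp_le_one_iff,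
          Nat.cast_sub (by omega)]
        push_cast; nlinarith
      -- Shortening t to t' costs only a factor 2 in t^m, since m ≤ n.
      have hbern : 1 / 2 ≤ (1 - 1 / (2 * n)) ^ m := by
        have h4 := one_add_mul_le_pow (a := -(1 / (2 * n))) (by linarith) m
        have h5 : (m : ℝ) * (1 / (2 * n)) ≤ 1 / 2 := by
          rw [mul_one_div, div_le_iff₀ (by positivity)]; linarith
        rw [← sub_eq_add_neg] at h4
        linarith
      have he : Real.exp (-1) ≤ Real.exp (-(r (m - 1) * t')) := Real.exp_le_exp.2 (by linarith)
      have hG : 0 ≤ (∏ i ∈ Finset.range m, r i) * (t ^ m / m.factorial) :=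
        mul_nonneg (Finset.prod_nonneg fun i _ => (hr0 i).le) (by positivity)
      calc _ = Real.exp (-1) * (1 / 2) *
            ((∏ i ∈ Finset.range m, r i) * (t ^ m / m.factorial)) := by
              simp only [hr, rate]; ring
        _ ≤ Real.exp (-(r (m - 1) * t')) * (1 - 1 / (2 * n)) ^ m *
            ((∏ i ∈ Finset.range m, r i) * (t ^ m / m.factorial)) := by gcongr
        _ = _ := by rw [ht']; ring
    · rw [hrate _ (by omega), hrate _ (by omega)]
      refine Real.exp_le_exp.2 ?_
      have : (i : ℝ) ≤ ((m - 1 : ℕ) : ℝ) := by exact_mod_cast (show i ≤ m - 1 by omega)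
      nlinarith
  have hfinal : Real.exp (-1) / 2 * (Real.exp (-(m * x) + A * (m * (m - 1)) / 2) / m.factorial)
      * Real.exp (-(1 + ((3 * Real.log n + 2) / A + 1) * (2 * Real.log n + 2)))
      ≤ (sumLaw r (N + 1)).real (Set.Iic (t - t / (4 * n))) := by
    have := isProbabilityMeasure_sumLaw hr0 (N + 1)
    have h3 := ENNReal.toReal_mono (measure_ne_top _ _) hsplit
    rw [ENNReal.toReal_mul, ENNReal.toReal_ofReal ((Real.exp_pos _).le.trans hprod)] at h3
    exact (mul_le_mul hlow hprod (Real.exp_pos _).le measureReal_nonneg).trans h3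
  refine le_trans ?_ (mul_le_mul_of_nonneg_left hfinal (Real.exp_pos _).le)
  have hf : (0 : ℝ) < m.factorial := by exact_mod_cast m.factorial_pos
  have h2e : Real.exp (-2) ≤ Real.exp (-1) / 2 := by
    have h3 : (2 : ℝ) ≤ Real.exp 1 := by linarith [Real.add_one_le_exp (1 : ℝ)]
    have h4 : Real.exp (-2) = Real.exp (-1) / Real.exp 1 := by
      rw [← Real.exp_sub]; norm_num
    rw [h4]; gcongr
  have h3 := log_factorial_le hm0
  have h4 := mul_log_sub_self_le_add (y := x / A) (m := m) (by rwa [le_div_iff₀ hA, one_mul])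
    (Nat.le_ceil _) (Nat.ceil_lt_add_one (div_nonneg (by linarith) hA.le)).le
  have h5 : - x ^ 2 / (2 * A) - x / 2 - A / 2 ≤ -(m * x) + A * (m * (m - 1)) / 2 := by
    have h6 : -(m * x) + A * (m * (m - 1)) / 2 - (- x ^ 2 / (2 * A) - x / 2 - A / 2)
        = ((A * m - x) ^ 2 + A * (A - (A * m - x))) / (2 * A) := by field_simp; ring
    have h7 : 0 ≤ ((A * m - x) ^ 2 + A * (A - (A * m - x))) / (2 * A) :=
      div_nonneg (by nlinarith) (by positivity)
    linarith
  have h6 : Real.log m ≤ Real.log n := Real.log_le_log (by linarith) hmN'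
  calc _ ≤ Real.exp (g * N) * (Real.exp (-2) *
        (Real.exp (-(m * x) + A * (m * (m - 1)) / 2) / Real.exp (Real.log m.factorial)) *
        Real.exp (-(1 + ((3 * Real.log n + 2) / A + 1) * (2 * Real.log n + 2)))) := by
        rw [← Real.exp_sub, ← Real.exp_add, ← Real.exp_add, ← Real.exp_add]
        refine Real.exp_le_exp.2 ?_
        rw [logMean, logErr]
        have : - x ^ 2 / (2 * A) = -(x ^ 2 / (2 * A)) := neg_div _ _
        linarith
    _ ≤ _ := by
        rw [Real.exp_log hf]
        gcongr

end

end RegularFragmentation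

/-! ### Failure probabilities at a fixed level and time. -/

namespace RegularFragmentation

section

variable {Ω : Type*} [MeasurableSpace Ω] {P : Measure Ω} [IsProbabilityMeasure P]
  {k : ℕ} {L : List (Fin k) → Ω → ℝ} {A s x : ℝ} {N : ℕ}

lemma exp_gam_mul_natCast (hk : 0 < k) (n : ℕ) : Real.exp (gam k * n) = (k : ℝ) ^ n := by
  rw [gam, mul_comm, Real.exp_nat_mul, Real.exp_log (by exact_mod_cast hk)]

lemma measureReal_exists_breakTime_le_exp (hk : 0 < k) (hL : ∀ v, Measurable (L v))
    (hind : iIndepFun L P) (hlaw : ∀ v, HasLaw (L v) (expMeasure (rate A v.length)) P)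
    (hA : 0 < A) (hx : x = N * A - s) (hy : A ≤ x) (hyN : x ≤ N * A) :
    P.real {ω | ∃ v : List (Fin k), v.length = N ∧ breakTime (fun w => L w ω) v ≤ Real.exp s}
      ≤ Real.exp (logMean A (gam k) N x + A / 2) := by
  refine (measureReal_exists_breakTime_le hL hind (rate_pos A) hlaw N _).trans ?_
  refine le_trans ?_ (exp_mul_sumLaw_ceil_le hA hx hy hyN)
  rw [exp_gam_mul_natCast hk]
  have := isProbabilityMeasure_sumLaw (r := fun i => rate A (N - i)) (fun _ => rate_pos _ _)
    ⌈x / A⌉₊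
  have hm : ⌈x / A⌉₊ ≤ N + 1 := by
    refine Nat.ceil_le.2 ?_
    rw [div_le_iff₀ hA]; push_cast; nlinarith
  exact mul_le_mul_of_nonneg_left (ENNReal.toReal_mono (measure_ne_top _ _)
    (sumLaw_Iic_antitone (fun _ => rate_pos _ _) _ hm)) (by positivity)

/-- The three terms come from near relatives, from distant relatives, and from a slow passage
through levels 0, …, l. -/
lemma measureReal_forall_exp_lt_breakTime_le (hk : 0 < k) (hL : ∀ v, Measurable (L v))
    (hL0 : ∀ v ω, 0 ≤ L v ω) (hind : iIndepFun L P)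
    (hlaw : ∀ v, HasLaw (L v) (expMeasure (rate A v.length)) P)
    (hA : 0 < A) (hx : x = N * A - s) (hy : A ≤ x) (hyN : x ≤ N * A) (hg : 2 * gam k ≤ x)
    {l : ℕ} (hl : l ≤ N) :
    P.real {ω | ∀ v : List (Fin k), v.length = N → Real.exp s < breakTime (fun w => L w ω) v}
      ≤ (N + 1) * (Real.exp (-logMean A (gam k) N x + logErr A (N + 1))
          + Real.exp (logErr A (N + 1) + A / 2 - gam k * l))
        + Real.exp (gam k * N) * ((N + 1) *
          Real.exp (-(rate A l * (Real.exp s / (4 * (N + 1) ^ 2))))) := by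
  have hk1 : (1 : ℝ) ≤ k := by exact_mod_cast hk
  have hk0 : (0 : ℝ) < k := by linarith
  set n : ℝ := N + 1 with hn
  have hn0 : 0 < n := by positivity
  have hln : (l : ℝ) + 1 ≤ n := by rw [hn]; exact_mod_cast (show l + 1 ≤ N + 1 by omega)
  have hl0 : (0 : ℝ) < l + 1 := by positivity
  set y := Real.exp s / (4 * n) / (l + 1) with hydef
  have hy0 : 0 ≤ y := by positivity
  have hly : (l + 1) * y = Real.exp s / (4 * n) := by rw [hydef]; field_simp
  have hmain := measureReal_forall_lt_breakTime_le (P := P) (rate_pos A) hlaw hl hy0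
    (b := rate A l) (fun i hi => Real.exp_le_exp.2 (by
      have : (i : ℝ) ≤ l := by exact_mod_cast hi
      nlinarith)) (Real.exp s)
  rw [hly] at hmain
  refine hmain.trans (add_le_add ?_ ?_)
  · set T := Real.exp s - Real.exp s / (4 * n) with hT
    have hTs : T ≤ Real.exp s := by
      have : 0 ≤ Real.exp s / (4 * n) := by positivity
      linarith
    set p := fun c => (sumLaw (fun i => rate A (N - i)) c).real (Set.Iic T) with hp
    have hr : ∀ i, 0 < (fun i => rate A (N - i)) i := fun _ => rate_pos _ _
    have hpp : ∀ c, IsProbabilityMeasure (sumLaw (fun i => rate A (N - i)) c) :=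
      isProbabilityMeasure_sumLaw hr
    have hpT : ∀ c, p c ≤ (sumLaw (fun i => rate A (N - i)) c).real (Set.Iic (Real.exp s)) :=
      fun c => measureReal_mono (Set.Iic_subset_Iic.2 hTs)
    have hanti : ∀ {c d : ℕ}, c ≤ d → (sumLaw (fun i => rate A (N - i)) d).real (Set.Iic T)
        ≤ (sumLaw (fun i => rate A (N - i)) c).real (Set.Iic T) := fun h =>
      ENNReal.toReal_mono (measure_ne_top _ _) (sumLaw_Iic_antitone hr T h)
    set D := logMean A (gam k) N x with hD
    set E := logErr A n with hE
    have h2 := measureReal_forall_lt_lineSum_mul_le hk hL hL0 hind (rate_pos A) hlaw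
      (N := N) (m := N - l) (by omega) T
    have hlow : Real.exp (D - E) ≤ k ^ N * p (N - l) := by
      rw [← exp_gam_mul_natCast hk]
      exact (le_exp_mul_sumLaw hA hx hy hyN).trans
        (mul_le_mul_of_nonneg_left (hanti (by omega)) (Real.exp_pos _).le)
    have hterm : ∀ c ∈ Finset.range (N - l),
        (k : ℝ) ^ c * p c ≤ 1 + Real.exp (D + A / 2 - gam k * l) := by
      intro c hc
      have hcN : c < N - l := Finset.mem_range.1 hc
      -- For distant relatives p c is at most the value at ⌈x/A⌉, and k^c ≤ k^{N-l} gains a factor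
      -- e^{-γl} over the bound for the mean.
      rcases le_or_gt c ⌈x / A⌉₊ with hcm | hcm
      · have hcx : A * ((c : ℝ) - 1) ≤ x := by
          have h3 : (c : ℝ) ≤ (⌈x / A⌉₊ : ℝ) := by exact_mod_cast hcm
          have := (ceil_div_bounds hA hy).2
          nlinarith
        have h4 := exp_mul_sumLaw_real_le_one (g := gam k) hx hg (c := c) (by omega) hcx
        rw [exp_gam_mul_natCast hk] at h4
        have h5 := mul_le_mul_of_nonneg_left (hpT c) (show (0 : ℝ) ≤ (k : ℝ) ^ c by positivity)
        linarith [Real.exp_pos (D + A / 2 - gam k * l)]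
      · have h3 := exp_mul_sumLaw_ceil_le (g := gam k) hA hx hy hyN
        have h4 : p c ≤ (sumLaw (fun i => rate A (N - i)) ⌈x / A⌉₊).real
            (Set.Iic (Real.exp s)) := (hanti hcm.le).trans (hpT _)
        have h5 : (k : ℝ) ^ c ≤ Real.exp (gam k * N) * Real.exp (-(gam k * l)) := by
          rw [← Real.exp_add]
          have : gam k * N + -(gam k * l) = gam k * (N - l : ℕ) := by
            rw [Nat.cast_sub hl]; ring
          rw [this, exp_gam_mul_natCast hk]
          exact pow_le_pow_right₀ hk1 hcN.le
        calc (k : ℝ) ^ c * p c ≤ Real.exp (gam k * N) * Real.exp (-(gam k * l)) *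
              (sumLaw (fun i => rate A (N - i)) ⌈x / A⌉₊).real (Set.Iic (Real.exp s)) :=
              mul_le_mul h5 h4 measureReal_nonneg (by positivity)
          _ = Real.exp (-(gam k * l)) * (Real.exp (gam k * N) *
              (sumLaw (fun i => rate A (N - i)) ⌈x / A⌉₊).real (Set.Iic (Real.exp s))) := by ring
          _ ≤ Real.exp (-(gam k * l)) * Real.exp (D + A / 2) :=
              mul_le_mul_of_nonneg_left h3 (Real.exp_pos _).le
          _ = Real.exp (D + A / 2 - gam k * l) := by rw [← Real.exp_add]; congr 1; ring
          _ ≤ _ := by linarith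
    have hsum := h2.trans (Finset.sum_le_card_nsmul _ _ _ hterm)
    rw [Finset.card_range, nsmul_eq_mul] at hsum
    have hcard : ((N - l : ℕ) : ℝ) ≤ n := by
      rw [hn]; exact_mod_cast (show N - l ≤ N + 1 by omega)
    set Q := P.real {ω | ∀ v : List (Fin k), v.length = N →
      T < lineSum (fun w => L w ω) (N - l) v} with hQ
    have hQ0 : 0 ≤ Q := measureReal_nonneg
    have h6 : Q * Real.exp (D - E) ≤ n * (1 + Real.exp (D + A / 2 - gam k * l)) :=
      (mul_le_mul_of_nonneg_left hlow hQ0).trans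
        (hsum.trans (mul_le_mul_of_nonneg_right hcard (by positivity)))
    calc Q = Q * Real.exp (D - E) * Real.exp (-D + E) := by
          rw [mul_assoc, ← Real.exp_add, show D - E + (-D + E) = 0 by ring, Real.exp_zero, mul_one]
      _ ≤ n * (1 + Real.exp (D + A / 2 - gam k * l)) * Real.exp (-D + E) :=
          mul_le_mul_of_nonneg_right h6 (Real.exp_pos _).le
      _ = _ := by
          have h7 : Real.exp (D + A / 2 - gam k * l) * Real.exp (-D + E)
              = Real.exp (E + A / 2 - gam k * l) := by
            rw [← Real.exp_add]; congr 1; ring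
          rw [← h7]; ring
  · rw [exp_gam_mul_natCast hk]
    have h1 : Real.exp s / (4 * n ^ 2) ≤ y := by
      rw [hydef, div_div, sq, ← mul_assoc]
      gcongr
    have h2 := mul_le_mul_of_nonneg_left h1 (rate_pos A l).le
    gcongr

end

end RegularFragmentation

/-! ### Asymptotics of the mean in the variable u = √(2γ log t). -/

namespace RegularFragmentation

open Filter Topology

lemma eventually_mul_one_add_log_sq_le (C : ℝ) :
    ∀ᶠ u : ℝ in atTop, C * (1 + Real.log u) ^ 2 ≤ u ^ (1 / 3 : ℝ) := by
  set ε : ℝ := 1 / (2 * (|C| + 1)) with hε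
  have hC : 0 ≤ |C| := abs_nonneg C
  have hε0 : 0 < ε := by positivity
  have h1 := (isLittleO_log_rpow_atTop (show (0 : ℝ) < 1 / 6 by norm_num)).bound hε0
  have h2 := (tendsto_rpow_atTop (show (0 : ℝ) < 1 / 6 by norm_num)).eventually_ge_atTop (1 / ε)
  filter_upwards [h1, h2, eventually_ge_atTop 1] with u h1 h2 hu
  have hu0 : 0 ≤ u := by linarith
  have hl : 0 ≤ Real.log u := Real.log_nonneg hu
  set v := u ^ (1 / 6 : ℝ) with hv
  have hv0 : 0 ≤ v := Real.rpow_nonneg hu0 _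
  have hvv : u ^ (1 / 3 : ℝ) = v ^ 2 := by
    rw [hv, ← Real.rpow_natCast, ← Real.rpow_mul hu0]; norm_num
  rw [Real.norm_of_nonneg hl, Real.norm_of_nonneg hv0] at h1
  rw [div_le_iff₀ hε0] at h2
  have h3 : 1 + Real.log u ≤ v / (|C| + 1) := by
    have : v / (|C| + 1) = 2 * (ε * v) := by rw [hε]; field_simp
    linarith
  rw [hvv]
  calc C * (1 + Real.log u) ^ 2 ≤ (|C| + 1) * (v / (|C| + 1)) ^ 2 := by
        gcongr
        linarith [le_abs_self C]
    _ = v ^ 2 / (|C| + 1) := by field_simp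
    _ ≤ v ^ 2 := div_le_self (by positivity) (by linarith)

/-- Write u²/2 - x²/2 = (u - x)²/2 + x(u - x). The constant in u - x then cancels the terms linear
in x, which is what dictates the constant in h. -/
lemma mul_logMean_eq {A g N x u η : ℝ} (hA : 0 < A) (hg : 0 < g) (hx0 : 0 < x)
    (hN : N * A = u ^ 2 / (2 * g) + x)
    (hx : x = u - Real.log u + (-(A / 2) + Real.log A + g + 1) + η) :
    A * logMean A g N x = x * (Real.log u - Real.log x - η) + (u - x) ^ 2 / 2 := by
  have hN' : N = (u ^ 2 / (2 * g) + x) / A := by rw [← hN]; field_simp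
  have hη : η = x - (u - Real.log u + (-(A / 2) + Real.log A + g + 1)) := by linarith
  rw [logMean, Real.log_div hx0.ne' hA.ne', hN', hη]
  field_simp
  ring

/-- The growth of the parameters: `x` is close to `u` and `N` is of the order of `u ^ 2`. -/
lemma eventually_param_bounds {A g : ℝ} (hA : 0 < A) (hg : 0 < g) (c B : ℝ) :
    ∀ᶠ u : ℝ in atTop, 1 ≤ u ∧ ∀ x N η : ℝ, |η| ≤ 1 → x = u - Real.log u + c + η →
      N * A = u ^ 2 / (2 * g) + x →
      B ≤ x ∧ u / 2 ≤ x ∧ x ≤ 2 * u ∧ |u - x| ≤ Real.log u + (|c| + 1) ∧ u ≤ N ∧ N + 1 ≤ u ^ 3 ∧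
        x ≤ u ^ 2 / (2 * g) / 2 := by
  set K := |c| + 1 with hK
  have hK0 : 0 < K := by positivity
  have h1 := (Real.isLittleO_log_id_atTop).bound (show (0 : ℝ) < 1 / 4 by norm_num)
  filter_upwards [h1, eventually_ge_atTop 1, eventually_ge_atTop (4 * K),
    eventually_ge_atTop (2 * B), eventually_ge_atTop (2 * g * A), eventually_ge_atTop (8 * g),
    eventually_ge_atTop (3 * (1 / (2 * g * A))), eventually_ge_atTop (3 * (2 / A)),
    eventually_ge_atTop 3]
    with u h1 hu1 hu2 hu3 hu4 hu5 hu6 hu7 hu8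
  refine ⟨hu1, fun x N η hη hx hN => ?_⟩
  have hu0 : 0 < u := by linarith
  have hl : 0 ≤ Real.log u := Real.log_nonneg hu1
  rw [Real.norm_of_nonneg hl, id, Real.norm_of_nonneg hu0.le] at h1
  obtain ⟨hη1, hη2⟩ := abs_le.1 hη
  have hc1 := le_abs_self c
  have hc2 := neg_abs_le c
  have hxl : u / 2 ≤ x := by linarith
  have hxu : x ≤ 2 * u := by linarith
  have hN' : N = u ^ 2 / (2 * g) / A + x / A := by rw [← add_div, ← hN]; field_simp
  have hxA : 0 ≤ x / A := div_nonneg (by linarith) hA.le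
  refine ⟨by linarith, hxl, hxu, ?_, ?_, ?_, ?_⟩
  · rw [abs_le]; constructor <;> linarith
  · have : u ≤ u ^ 2 / (2 * g) / A := by
      rw [div_div, le_div_iff₀ (by positivity), sq]
      exact mul_le_mul_of_nonneg_left hu4 hu0.le
    linarith
  · have e1 : u ^ 2 / (2 * g) / A = 1 / (2 * g * A) * u ^ 2 := by field_simp
    have e2 : x / A ≤ 2 / A * u := by
      rw [div_mul_eq_mul_div]; gcongr
    have e3 : 1 / (2 * g * A) * u ^ 2 ≤ u / 3 * u ^ 2 :=
      mul_le_mul_of_nonneg_right (by linarith) (by positivity)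
    have e4 : 2 / A * u ≤ u / 3 * u := mul_le_mul_of_nonneg_right (by linarith) hu0.le
    have e5 : u / 3 * u ≤ u / 3 * u ^ 2 :=
      mul_le_mul_of_nonneg_left (le_self_pow₀ hu1 two_ne_zero) (by positivity)
    have e6 : 1 ≤ u / 3 * u ^ 2 :=
      one_le_mul_of_one_le_of_one_le (by linarith) (one_le_pow₀ hu1)
    have e7 : u ^ 3 = 3 * (u / 3 * u ^ 2) := by ring
    linarith
  · have h9 := mul_le_mul_of_nonneg_left hu5 hu0.le
    rw [div_div, le_div_iff₀ (by positivity), sq]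
    exact (mul_le_mul_of_nonneg_right hxu (by positivity)).trans (by linarith)

section

variable {A g d : ℝ}

lemma eventually_abs_le_one (d : ℝ) : ∀ᶠ u : ℝ in atTop, |d * u ^ (-(2 / 3) : ℝ)| ≤ 1 := by
  have h := (tendsto_rpow_neg_atTop (show (0 : ℝ) < 2 / 3 by norm_num)).const_mul d
  rw [mul_zero] at h
  filter_upwards [h.abs.eventually_le_const (show |(0 : ℝ)| < 1 by simp)] with u hu using hu

lemma mul_rpow_lower {u x : ℝ} (hd : 0 < d) (hu : 1 ≤ u) (hx : u / 2 ≤ x) :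
    d / 2 * u ^ (1 / 3 : ℝ) ≤ x * (d * u ^ (-(2 / 3) : ℝ)) := by
  have hu0 : 0 < u := by linarith
  have h1 : u ^ (1 / 3 : ℝ) = u * u ^ (-(2 / 3) : ℝ) := by
    rw [← Real.rpow_one_add' hu0.le (by norm_num)]; norm_num
  have h2 : 0 ≤ u ^ (-(2 / 3) : ℝ) := Real.rpow_nonneg hu0.le _
  rw [h1]
  nlinarith [mul_nonneg hd.le h2]

lemma log_add_one_le {u N : ℝ} (hu : 1 ≤ u) (hN : u ≤ N) (hNu : N + 1 ≤ u ^ 3) :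
    0 ≤ Real.log (N + 1) ∧ Real.log (N + 1) ≤ 3 * Real.log u := by
  refine ⟨Real.log_nonneg (by linarith), ?_⟩
  have := Real.log_le_log (by linarith) hNu
  rw [Real.log_pow] at this
  exact_mod_cast this

lemma le_one_add_sq {ℓ : ℝ} (hl : 0 ≤ ℓ) :
    1 ≤ (1 + ℓ) ^ 2 ∧ ℓ ≤ (1 + ℓ) ^ 2 ∧ 1 + ℓ ≤ (1 + ℓ) ^ 2 :=
  ⟨by nlinarith, by nlinarith, by nlinarith⟩

/-- Here xη is at least (d/2)u^{1/3}, while x(log u - log x) ≤ u - x and (u - x)² are O(log² u). -/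
lemma eventually_logMean_le (hA : 0 < A) (hg : 0 < g) (hd : 0 < d) :
    ∀ᶠ u : ℝ in atTop, ∀ x N : ℝ,
      x = u - Real.log u + (-(A / 2) + Real.log A + g + 1) + d * u ^ (-(2 / 3) : ℝ) →
      N * A = u ^ 2 / (2 * g) + x →
      A ≤ x ∧ logMean A g N x + A / 2 ≤ -(2 * Real.log (N + 1)) := by
  set c := -(A / 2) + Real.log A + g + 1 with hc
  set K := |c| + 1 with hK
  have hK1 : 1 ≤ K := by have := abs_nonneg c; linarith
  filter_upwards [eventually_param_bounds hA hg c A, eventually_abs_le_one d,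
    eventually_mul_one_add_log_sq_le (2 / d * (K + K ^ 2 / 2 + A ^ 2 / 2 + 6 * A))]
    with u h1 h2 h3 x N hx hN
  obtain ⟨hu1, h1⟩ := h1
  obtain ⟨hxA, hxl, hxu, hw, hNl, hNu, -⟩ := h1 x N _ h2 hx hN
  refine ⟨hxA, ?_⟩
  have hu0 : 0 < u := by linarith
  have hx0 : 0 < x := by linarith
  obtain ⟨-, hlogN⟩ := log_add_one_le hu1 hNl hNu
  have hl := Real.log_nonneg hu1
  set ℓ := Real.log u with hℓ
  have hmean := mul_logMean_eq hA hg hx0 hN hx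
  have hlow := mul_rpow_lower hd hu1 hxl
  have hlogx : x * (ℓ - Real.log x) ≤ u - x := by
    have h4 := Real.add_one_le_exp (Real.log (u / x))
    rw [Real.exp_log (by positivity), Real.log_div hu0.ne' hx0.ne', le_div_iff₀ hx0] at h4
    linarith
  have hw1 : u - x ≤ ℓ + K := (le_abs_self _).trans hw
  have hw2 : (u - x) ^ 2 ≤ (ℓ + K) ^ 2 := by
    rw [← sq_abs]; exact pow_le_pow_left₀ (abs_nonneg _) hw 2
  have hKl : ℓ + K ≤ K * (1 + ℓ) := by
    have := mul_le_mul_of_nonneg_right hK1 hl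
    linarith
  have hKl2 : (ℓ + K) ^ 2 ≤ (K * (1 + ℓ)) ^ 2 := pow_le_pow_left₀ (by positivity) hKl 2
  have h5 : K + K ^ 2 / 2 + A ^ 2 / 2 + 6 * A ≥ 0 := by positivity
  have h6 : (K + K ^ 2 / 2 + A ^ 2 / 2 + 6 * A) * (1 + ℓ) ^ 2 ≤ d / 2 * u ^ (1 / 3 : ℝ) := by
    calc _ = d / 2 * (2 / d * (K + K ^ 2 / 2 + A ^ 2 / 2 + 6 * A) * (1 + ℓ) ^ 2) := by
          field_simp
      _ ≤ _ := mul_le_mul_of_nonneg_left h3 (by positivity)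
  obtain ⟨h8, h9, h7⟩ := le_one_add_sq hl
  have h10 : K * (1 + ℓ) ≤ K * (1 + ℓ) ^ 2 := by gcongr
  have h11 : A ^ 2 / 2 * 1 ≤ A ^ 2 / 2 * (1 + ℓ) ^ 2 := by gcongr
  have h12 : 6 * A * ℓ ≤ 6 * A * (1 + ℓ) ^ 2 := by gcongr
  have hfin : A * (logMean A g N x + A / 2) ≤ A * -(2 * Real.log (N + 1)) := by
    have : A * (2 * Real.log (N + 1)) ≤ A * (2 * (3 * ℓ)) := by gcongr
    linarith
  exact le_of_mul_le_mul_left hfin hA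

lemma logErr_le (hA : 0 < A) {n ℓ : ℝ} (hn : 0 ≤ Real.log n) (hℓ : Real.log n ≤ 3 * ℓ) :
    logErr A n ≤ (A / 2 + 10 + (9 / A + 1) * 6) * (1 + ℓ) ^ 2 := by
  have hl : 0 ≤ ℓ := by linarith
  have h1 : (3 * Real.log n + 2) / A + 1 ≤ (9 / A + 1) * (1 + ℓ) := by
    have : (3 * Real.log n + 2) / A ≤ 9 * (1 + ℓ) / A := by gcongr; linarith
    have e : 9 * (1 + ℓ) / A = 9 / A * (1 + ℓ) := by ring
    linarith
  have h2 : 2 * Real.log n + 2 ≤ 6 * (1 + ℓ) := by linarith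
  have h3 := mul_le_mul h1 h2 (by linarith) (by positivity)
  obtain ⟨h4, -, h5⟩ := le_one_add_sq hl
  have h6 : A / 2 * 1 ≤ A / 2 * (1 + ℓ) ^ 2 := by gcongr
  rw [logErr]
  linarith

/-- The last three bounds make the exponential factors in the error terms of
`measureReal_forall_exp_lt_breakTime_le`, for l = N/2, at most (N + 1)^{-3}. -/
lemma eventually_le_logMean (hA : 0 < A) (hg : 0 < g) (hd : 0 < d) :
    ∀ᶠ u : ℝ in atTop, ∀ x N : ℝ,
      x = u - Real.log u + (-(A / 2) + Real.log A + g + 1) + -(d * u ^ (-(2 / 3) : ℝ)) →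
      N * A = u ^ 2 / (2 * g) + x →
      A ≤ x ∧ 2 * g ≤ x ∧
      -logMean A g N x + logErr A (N + 1) ≤ -(3 * Real.log (N + 1)) ∧
      logErr A (N + 1) + A / 2 - g * ((N - 1) / 2) ≤ -(3 * Real.log (N + 1)) ∧
      g * N - Real.exp (u ^ 2 / (2 * g) - A * (N / 2)) / (4 * (N + 1) ^ 2)
        ≤ -(3 * Real.log (N + 1)) := by
  set c := -(A / 2) + Real.log A + g + 1 with hc
  set K := A / 2 + 10 + (9 / A + 1) * 6 with hK
  have hK0 : 0 ≤ K := by positivity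
  -- Since N + 1 ≤ u³, the target (g + 9)u³ times 4(N + 1)² is at most 4(g + 9)u⁹.
  have hexp : ∀ᶠ u : ℝ in atTop, 4 * (g + 9) ≤ Real.exp u / u ^ 9 :=
    (Real.tendsto_exp_div_pow_atTop 9).eventually_ge_atTop _
  filter_upwards [eventually_param_bounds hA hg c (A + 2 * g), eventually_abs_le_one (-d),
    eventually_mul_one_add_log_sq_le (2 * A / d * (K + 9)),
    eventually_mul_one_add_log_sq_le (2 / g * (K + 9 + A / 2 + g / 2)),
    eventually_ge_atTop (Real.exp |c|), hexp, eventually_ge_atTop (8 * g)]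
    with u h1 h2 h3 h4 h5 h6 h7 x N hx hN
  obtain ⟨hu1, h1⟩ := h1
  have hx' : x = u - Real.log u + c + -d * u ^ (-(2 / 3) : ℝ) := by rw [hx]; ring
  obtain ⟨hxB, hxl, hxu, hw, hNl, hNu, hxs⟩ := h1 x N _ h2 hx' hN
  have hu0 : 0 < u := by linarith
  have hx0 : 0 < x := by linarith
  obtain ⟨hlogN0, hlogN⟩ := log_add_one_le hu1 hNl hNu
  have hl := Real.log_nonneg hu1
  have hE := logErr_le hA hlogN0 hlogN
  rw [← hK] at hE
  -- This forces x ≤ u, so the two terms of the mean other than -xη are nonnegative and can be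
  -- dropped.
  have hcl : |c| ≤ Real.log u := by rwa [Real.le_log_iff_exp_le hu0]
  set ℓ := Real.log u with hℓ
  obtain ⟨h8, h9, -⟩ := le_one_add_sq hl
  refine ⟨by linarith, by linarith, ?_, ?_, ?_⟩
  · have hmean := mul_logMean_eq hA hg hx0 hN hx
    have hlow := mul_rpow_lower hd hu1 hxl
    have hr0 : 0 ≤ d * u ^ (-(2 / 3) : ℝ) := mul_nonneg hd.le (Real.rpow_nonneg hu0.le _)
    have hxu' : x ≤ u := by linarith [le_abs_self c]
    have hlogx : 0 ≤ x * (ℓ - Real.log x) :=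
      mul_nonneg hx0.le (sub_nonneg.2 (Real.log_le_log hx0 hxu'))
    have hD : d / 2 * u ^ (1 / 3 : ℝ) ≤ A * logMean A g N x := by
      linarith [sq_nonneg (u - x)]
    have h10 : A * ((K + 9) * (1 + ℓ) ^ 2) ≤ d / 2 * u ^ (1 / 3 : ℝ) := by
      calc _ = d / 2 * (2 * A / d * (K + 9) * (1 + ℓ) ^ 2) := by field_simp
        _ ≤ _ := mul_le_mul_of_nonneg_left h3 (by positivity)
    have h11 := le_of_mul_le_mul_left (h10.trans hD) hA
    linarith
  · have h10 : u ^ (1 / 3 : ℝ) ≤ u := by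
      calc u ^ (1 / 3 : ℝ) ≤ u ^ (1 : ℝ) := Real.rpow_le_rpow_of_exponent_le hu1 (by norm_num)
        _ = u := Real.rpow_one u
    have h11 : (K + 9 + A / 2 + g / 2) * (1 + ℓ) ^ 2 ≤ g / 2 * N := by
      calc _ = g / 2 * (2 / g * (K + 9 + A / 2 + g / 2) * (1 + ℓ) ^ 2) := by field_simp
        _ ≤ _ := mul_le_mul_of_nonneg_left (h4.trans (h10.trans hNl)) (by positivity)
    have h12 : A / 2 * 1 ≤ A / 2 * (1 + ℓ) ^ 2 := by gcongr
    have h13 : g / 2 * 1 ≤ g / 2 * (1 + ℓ) ^ 2 := by gcongr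
    linarith
  · have h10 : u ≤ u ^ 2 / (2 * g) - A * (N / 2) := by
      have e1 : A * (N / 2) = (u ^ 2 / (2 * g) + x) / 2 := by rw [← hN]; ring
      have e2 : u ≤ u ^ 2 / (2 * g) / 4 := by
        have := mul_le_mul_of_nonneg_left h7 hu0.le
        rw [div_div, le_div_iff₀ (by positivity), sq]
        linarith
      linarith
    have h11 : 4 * (g + 9) * u ^ 9 ≤ Real.exp u := by rwa [le_div_iff₀ (by positivity)] at h6
    have h12 : (g + 9) * u ^ 3 ≤ Real.exp (u ^ 2 / (2 * g) - A * (N / 2)) / (4 * (N + 1) ^ 2) := by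
      have hN0 : 0 < N + 1 := by linarith
      rw [le_div_iff₀ (by positivity)]
      calc (g + 9) * u ^ 3 * (4 * (N + 1) ^ 2) ≤ (g + 9) * u ^ 3 * (4 * (u ^ 3) ^ 2) := by
            gcongr
        _ = 4 * (g + 9) * u ^ 9 := by ring
        _ ≤ Real.exp u := h11
        _ ≤ _ := Real.exp_le_exp.2 h10
    have h13 : g * N ≤ g * u ^ 3 := by gcongr; linarith
    have h14 : ℓ ≤ u ^ 3 := by
      have := Real.log_le_sub_one_of_pos hu0
      linarith [le_self_pow₀ hu1 three_ne_zero]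
    linarith

end

end RegularFragmentation

/-! ### The function h in the variable u, and Borel-Cantelli over the levels. -/

namespace RegularFragmentation

open Filter Topology

section

variable {k : ℕ} {α : ℝ}

lemma gam_pos (hk : 2 ≤ k) : 0 < gam k := Real.log_pos (by exact_mod_cast hk)

/-- The terms -½ log log t and -½ log(2γ) of h combine into -log u. -/
lemma gam_mul_mul_h {s : ℝ} (hk : 2 ≤ k) (hα : 0 < α) (hs : 0 < s) :
    gam k * α * h k α (Real.exp s) = s + (Real.sqrt (2 * gam k * s)
      - Real.log (Real.sqrt (2 * gam k * s))
      + (-(gam k * α / 2) + Real.log (gam k * α) + gam k + 1)) := by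
  have hg := gam_pos hk
  have hA : 0 < gam k * α := mul_pos hg hα
  have h1 : Real.log (Real.sqrt (2 * gam k * s))
      = 1 / 2 * Real.log (2 * gam k) + 1 / 2 * Real.log s := by
    rw [Real.log_sqrt (by positivity), Real.log_mul (by positivity) hs.ne']; ring
  have h2 : Real.log (kap k α) = -Real.log (gam k * α) := by
    rw [kap, one_div, Real.log_inv]
  have h3 : gam k * α * kap k α = 1 := by rw [kap, mul_one_div, div_self hA.ne']
  have h4 : 1 / (2 * kap k α) = gam k * α / 2 := by rw [kap]; field_simp
  rw [h, Real.log_exp, ← mul_assoc, h3, cst, h4, h2, h1]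
  ring

lemma gam_mul_mul_mu2 {s : ℝ} (hk : 2 ≤ k) (hα : 0 < α) (hs : 0 < s) :
    gam k * α * (mu2 k α * (1 / s ^ (1 / 3 : ℝ)))
      = 2 * (2 * gam k * (gam k * α)) ^ (1 / 3 : ℝ)
        * Real.sqrt (2 * gam k * s) ^ (-(2 / 3) : ℝ) := by
  have hg := gam_pos hk
  set A := gam k * α with hAdef
  have hA : 0 < A := mul_pos hg hα
  have hs2 : 0 ≤ 2 * gam k * s := by positivity
  have h1 : Real.sqrt (2 * gam k * s) ^ (-(2 / 3) : ℝ)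
      = ((2 * gam k) ^ (1 / 3 : ℝ) * s ^ (1 / 3 : ℝ))⁻¹ := by
    rw [Real.sqrt_eq_rpow, ← Real.rpow_mul hs2, ← Real.mul_rpow (by positivity) hs.le,
      ← Real.rpow_neg (by positivity)]
    norm_num
  have h2 : (2 * gam k * A) ^ (1 / 3 : ℝ) = (2 * gam k) ^ (1 / 3 : ℝ) * A ^ (1 / 3 : ℝ) :=
    Real.mul_rpow (by positivity) hA.le
  have h3 : A * kap k α ^ (2 / 3 : ℝ) = A ^ (1 / 3 : ℝ) := by
    rw [kap, ← hAdef, one_div, Real.inv_rpow hA.le, ← Real.rpow_neg hA.le,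
      ← Real.rpow_one_add' hA.le (by norm_num)]
    norm_num
  have h4 : (2 * gam k) ^ (1 / 3 : ℝ) ≠ 0 := (Real.rpow_pos_of_pos (by positivity) _).ne'
  rw [h1, h2, mu2, ← h3]
  field_simp

lemma continuousOn_h_exp : ContinuousOn (fun s => h k α (Real.exp s)) (Set.Ioi 0) := by
  have hne : ∀ s ∈ Set.Ioi (0 : ℝ), s ≠ 0 := fun s hs => ne_of_gt hs
  simp only [h, Real.log_exp]
  fun_prop

lemma continuousOn_eps : ContinuousOn (fun s => mu2 k α * (1 / s ^ (1 / 3 : ℝ)))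
    (Set.Ioi (0 : ℝ)) := by
  refine continuousOn_const.mul (continuousOn_const.div ?_ fun s hs => ?_)
  · exact continuousOn_id.rpow_const fun s _ => Or.inr (by norm_num)
  · exact (Real.rpow_pos_of_pos hs _).ne'

lemma mu2_nonneg (hk : 2 ≤ k) (hα : 0 < α) : 0 ≤ mu2 k α := by
  have := gam_pos hk
  exact mul_nonneg two_pos.le (Real.rpow_nonneg (by rw [kap]; positivity) _)

lemma hLower_le_hUpper_exp (hk : 2 ≤ k) (hα : 0 < α) {s : ℝ} (hs : 0 < s) :
    hLower k α (Real.exp s) ≤ hUpper k α (Real.exp s) := by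
  have := mu2_nonneg hk hα
  rw [hLower, hUpper, Real.log_exp]
  have h : 0 ≤ mu2 k α * (1 / s ^ (1 / 3 : ℝ)) :=
    mul_nonneg this (one_div_nonneg.2 (Real.rpow_nonneg hs.le _))
  linarith

lemma tendsto_hLower_exp (hk : 2 ≤ k) (hα : 0 < α) :
    Tendsto (fun s => hLower k α (Real.exp s)) atTop atTop := by
  have hg := gam_pos hk
  have hκ : 0 < kap k α := by rw [kap]; positivity
  have hlin : Tendsto (fun s : ℝ => kap k α * (1 / 2 * s + cst k α) - mu2 k α) atTop atTop :=
    tendsto_atTop_add_const_right _ _ (Tendsto.const_mul_atTop hκ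
      (tendsto_atTop_add_const_right _ _ (Tendsto.const_mul_atTop (by norm_num) tendsto_id)))
  refine tendsto_atTop_mono' _ ?_ hlin
  filter_upwards [eventually_ge_atTop 1] with s hs
  have hs0 : 0 < s := by linarith
  have h1 : Real.log s ≤ s := by linarith [Real.log_le_sub_one_of_pos hs0]
  have h2 : 1 / s ^ (1 / 3 : ℝ) ≤ 1 := by
    rw [div_le_one (Real.rpow_pos_of_pos hs0 _)]
    exact Real.one_le_rpow hs (by norm_num)
  have h3 := mul_le_mul_of_nonneg_left h2 (mu2_nonneg hk hα)
  have h4 := Real.sqrt_nonneg (2 * gam k * s)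
  rw [hLower, h, Real.log_exp]
  have h5 : kap k α * (1 / 2 * s + cst k α) ≤ kap k α * (s + Real.sqrt (2 * gam k * s)
      - 1 / 2 * Real.log s + cst k α) := mul_le_mul_of_nonneg_left (by linarith) hκ.le
  linarith

lemma tendsto_hUpper_exp (hk : 2 ≤ k) (hα : 0 < α) :
    Tendsto (fun s => hUpper k α (Real.exp s)) atTop atTop := by
  refine tendsto_atTop_mono' _ ?_ (tendsto_hLower_exp hk hα)
  filter_upwards [eventually_gt_atTop 0] with s hs using hLower_le_hUpper_exp hk hα hs

lemma continuousOn_hLower_exp : ContinuousOn (fun s => hLower k α (Real.exp s)) (Set.Ioi 0) := by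
  simp only [hLower, Real.log_exp]
  exact continuousOn_h_exp.sub continuousOn_eps

lemma continuousOn_hUpper_exp : ContinuousOn (fun s => hUpper k α (Real.exp s)) (Set.Ioi 0) := by
  simp only [hUpper, Real.log_exp]
  exact continuousOn_h_exp.add continuousOn_eps

end

/-- Monotonicity is not needed: the last point of the sublevel set has value y by the intermediate
value theorem to its right. -/
lemma exists_last_eq {f : ℝ → ℝ} {a y : ℝ} (hf : ContinuousOn f (Set.Ici a))
    (hlim : Tendsto f atTop atTop) (hy : f a ≤ y) :
    ∃ b, a ≤ b ∧ f b = y ∧ ∀ s, a ≤ s → f s ≤ y → s ≤ b := by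
  set S := Set.Ici a ∩ f ⁻¹' Set.Iic y with hS
  have hcl : IsClosed S := hf.preimage_isClosed_of_isClosed isClosed_Ici isClosed_Iic
  obtain ⟨B, hB⟩ := eventually_atTop.1 (hlim.eventually_gt_atTop y)
  have hbdd : BddAbove S := ⟨B, fun s hs => by
    by_contra hlt
    exact absurd hs.2 (not_le.2 (hB s (not_le.1 hlt).le))⟩
  have hmem : sSup S ∈ S := hcl.csSup_mem ⟨a, Set.mem_Ici.2 le_rfl, hy⟩ hbdd
  refine ⟨sSup S, hmem.1, ?_, fun s h1 h2 => le_csSup hbdd ⟨h1, h2⟩⟩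
  have hle : sSup S ≤ max (sSup S) B := le_max_left _ _
  obtain ⟨b, hb, hfb⟩ := intermediate_value_Icc hle
    (hf.mono fun s hs => (show a ≤ sSup S from hmem.1).trans hs.1)
    ⟨hmem.2, (hB _ (le_max_right _ _)).le⟩
  have : b ≤ sSup S := le_csSup hbdd ⟨(show a ≤ sSup S from hmem.1).trans hb.1, hfb.le⟩
  rw [le_antisymm hb.1 this, hfb]

lemma exists_first_eq {f : ℝ → ℝ} {a y : ℝ} (hf : ContinuousOn f (Set.Ici a))
    (hlim : Tendsto f atTop atTop) (hy : f a ≤ y) :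
    ∃ b, a ≤ b ∧ f b = y ∧ ∀ s, a ≤ s → y ≤ f s → b ≤ s := by
  set S := Set.Ici a ∩ f ⁻¹' Set.Ici y with hS
  have hcl : IsClosed S := hf.preimage_isClosed_of_isClosed isClosed_Ici isClosed_Ici
  obtain ⟨B, hB⟩ := eventually_atTop.1 (hlim.eventually_gt_atTop y)
  have hbdd : BddBelow S := ⟨a, fun s hs => hs.1⟩
  have hmem : sInf S ∈ S :=
    hcl.csInf_mem ⟨max a B, Set.mem_Ici.2 (le_max_left _ _), (hB _ (le_max_right _ _)).le⟩ hbdd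
  refine ⟨sInf S, hmem.1, ?_, fun s h1 h2 => csInf_le hbdd ⟨h1, h2⟩⟩
  obtain ⟨b, hb, hfb⟩ := intermediate_value_Icc (show a ≤ sInf S from hmem.1)
    (hf.mono fun s hs => hs.1) ⟨hy, hmem.2⟩
  have : sInf S ≤ b := csInf_le hbdd ⟨hb.1, hfb.ge⟩
  rw [le_antisymm this hb.2, hfb]

section

variable {Ω : Type*} [MeasurableSpace Ω] {P : Measure Ω} [IsProbabilityMeasure P]

lemma ae_eventually_notMem_of_le {S : ℕ → Set Ω} {C : ℝ} (hC : 0 ≤ C) {N₀ : ℕ}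
    (hS : ∀ N, N₀ ≤ N → P.real (S N) ≤ C / ((N : ℝ) + 1) ^ 2) :
    ∀ᵐ ω ∂P, ∃ N₁, ∀ N, N₁ ≤ N → ω ∉ S N := by
  have hsum : Summable fun N : ℕ => C / ((N : ℝ) + 1) ^ 2 := by
    have h := (summable_nat_add_iff 1).2 (Real.summable_one_div_nat_pow.2 one_lt_two)
    have := h.mul_left C
    simpa [div_eq_mul_inv] using this
  have hle : ∀ N, P (S (N + N₀)) ≤ ENNReal.ofReal (C / ((N : ℝ) + 1) ^ 2) := by
    intro N
    refine (ENNReal.le_ofReal_iff_toReal_le (measure_ne_top _ _) (by positivity)).2 ?_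
    refine (hS (N + N₀) (by omega)).trans ?_
    push_cast
    gcongr
    linarith [show (0 : ℝ) ≤ N₀ from N₀.cast_nonneg]
  have hne : ∑' N, P (S (N + N₀)) ≠ ⊤ :=
    ne_top_of_le_ne_top hsum.tsum_ofReal_ne_top (ENNReal.tsum_le_tsum hle)
  filter_upwards [ae_eventually_notMem hne] with ω hω
  obtain ⟨M, hM⟩ := eventually_atTop.1 hω
  refine ⟨M + N₀, fun N hN => ?_⟩
  have := hM (N - N₀) (by omega)
  rwa [Nat.sub_add_cancel (by omega)] at this

variable {k : ℕ} {α : ℝ} {L : List (Fin k) → Ω → ℝ}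

lemma tendsto_sqrt_two_gam_mul (hk : 2 ≤ k) :
    Tendsto (fun s : ℝ => Real.sqrt (2 * gam k * s)) atTop atTop :=
  Real.tendsto_sqrt_atTop.comp
    (Tendsto.const_mul_atTop (mul_pos two_pos (gam_pos hk)) tendsto_id)

lemma eventually_measureReal_exists_breakTime_le (hk : 2 ≤ k) (hα : 0 < α)
    (hL : ∀ v, Measurable (L v)) (hind : iIndepFun L P)
    (hlaw : ∀ v, HasLaw (L v) (expMeasure (rate (gam k * α) v.length)) P) :
    ∀ᶠ s in atTop, ∀ N : ℕ, hUpper k α (Real.exp s) = N →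
      P.real {ω | ∃ v : List (Fin k), v.length = N ∧ breakTime (fun w => L w ω) v ≤ Real.exp s}
        ≤ 1 / ((N : ℝ) + 1) ^ 2 := by
  have hg := gam_pos hk
  have hA : 0 < gam k * α := mul_pos hg hα
  set d := 2 * (2 * gam k * (gam k * α)) ^ (1 / 3 : ℝ) with hd
  have hd0 : 0 < d := by positivity
  filter_upwards [(tendsto_sqrt_two_gam_mul hk).eventually (eventually_logMean_le hA hg hd0),
    eventually_gt_atTop 0] with s hs hs0 N hN
  have husq : Real.sqrt (2 * gam k * s) ^ 2 / (2 * gam k) = s := by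
    rw [Real.sq_sqrt (by positivity)]; field_simp
  have hNA : (N : ℝ) * (gam k * α) = s + (Real.sqrt (2 * gam k * s)
      - Real.log (Real.sqrt (2 * gam k * s))
      + (-(gam k * α / 2) + Real.log (gam k * α) + gam k + 1)
      + d * Real.sqrt (2 * gam k * s) ^ (-(2 / 3) : ℝ)) := by
    rw [← hN, hUpper, mul_comm, mul_add, Real.log_exp, gam_mul_mul_h hk hα hs0,
      gam_mul_mul_mu2 hk hα hs0]
    ring
  obtain ⟨h1, h2⟩ := hs _ N rfl (by rw [husq]; exact hNA)
  set x := Real.sqrt (2 * gam k * s) - Real.log (Real.sqrt (2 * gam k * s))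
      + (-(gam k * α / 2) + Real.log (gam k * α) + gam k + 1)
      + d * Real.sqrt (2 * gam k * s) ^ (-(2 / 3) : ℝ) with hx
  refine (measureReal_exists_breakTime_le_exp (x := x) (by omega) hL hind hlaw hA (by linarith) h1
    (by linarith)).trans ((Real.exp_le_exp.2 h2).trans_eq ?_)
  have hN1 : (0 : ℝ) < N + 1 := by positivity
  rw [Real.exp_neg, one_div, mul_comm, Real.exp_mul, Real.exp_log hN1]
  norm_num

lemma eventually_measureReal_forall_lt_breakTime_le (hk : 2 ≤ k) (hα : 0 < α)
    (hL : ∀ v, Measurable (L v)) (hL0 : ∀ v ω, 0 ≤ L v ω) (hind : iIndepFun L P)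
    (hlaw : ∀ v, HasLaw (L v) (expMeasure (rate (gam k * α) v.length)) P) :
    ∀ᶠ s in atTop, ∀ N : ℕ, hLower k α (Real.exp s) = N →
      P.real {ω | ∀ v : List (Fin k), v.length = N → Real.exp s < breakTime (fun w => L w ω) v}
        ≤ 3 / ((N : ℝ) + 1) ^ 2 := by
  have hg := gam_pos hk
  have hA : 0 < gam k * α := mul_pos hg hα
  set d := 2 * (2 * gam k * (gam k * α)) ^ (1 / 3 : ℝ) with hd
  have hd0 : 0 < d := by positivity
  filter_upwards [(tendsto_sqrt_two_gam_mul hk).eventually (eventually_le_logMean hA hg hd0),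
    eventually_gt_atTop 0] with s hs hs0 N hN
  have husq : Real.sqrt (2 * gam k * s) ^ 2 / (2 * gam k) = s := by
    rw [Real.sq_sqrt (by positivity)]; field_simp
  rw [husq] at hs
  have hNA : (N : ℝ) * (gam k * α) = s + (Real.sqrt (2 * gam k * s)
      - Real.log (Real.sqrt (2 * gam k * s))
      + (-(gam k * α / 2) + Real.log (gam k * α) + gam k + 1)
      + -(d * Real.sqrt (2 * gam k * s) ^ (-(2 / 3) : ℝ))) := by
    rw [← hN, hLower, mul_comm, mul_sub, Real.log_exp, gam_mul_mul_h hk hα hs0,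
      gam_mul_mul_mu2 hk hα hs0]
    ring
  obtain ⟨h1, h2, h3, h4, h5⟩ := hs _ N rfl hNA
  set x := Real.sqrt (2 * gam k * s) - Real.log (Real.sqrt (2 * gam k * s))
      + (-(gam k * α / 2) + Real.log (gam k * α) + gam k + 1)
      + -(d * Real.sqrt (2 * gam k * s) ^ (-(2 / 3) : ℝ)) with hx
  -- With l = N/2, γl dominates log² N, and levels up to l are still fast because s - AN/2 ≥ u.
  have hmain := measureReal_forall_exp_lt_breakTime_le (P := P) (x := x) (s := s) (l := N / 2) (by omega)
    hL hL0 hind hlaw hA (by linarith) h1 (by linarith) h2 (Nat.div_le_self N 2)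
  refine hmain.trans ?_
  have hl1 : ((N : ℝ) - 1) / 2 ≤ ((N / 2 : ℕ) : ℝ) := by
    have : (N : ℝ) ≤ 2 * ((N / 2 : ℕ) : ℝ) + 1 := by
      exact_mod_cast (show N ≤ 2 * (N / 2) + 1 by omega)
    linarith
  have hl2 : ((N / 2 : ℕ) : ℝ) ≤ (N : ℝ) / 2 := Nat.cast_div_le
  set n : ℝ := N + 1 with hn
  have hn0 : 0 < n := by positivity
  have hexp : Real.exp (-(3 * Real.log n)) = 1 / n ^ 3 := by
    rw [Real.exp_neg, one_div, mul_comm, Real.exp_mul, Real.exp_log hn0]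
    norm_num
  have e1 := Real.exp_le_exp.2 h3
  have e2 : Real.exp (logErr (gam k * α) n + gam k * α / 2 - gam k * ((N / 2 : ℕ) : ℝ))
      ≤ Real.exp (-(3 * Real.log n)) := by
    refine Real.exp_le_exp.2 (le_trans ?_ h4)
    have := mul_le_mul_of_nonneg_left hl1 hg.le
    linarith
  have e3 : Real.exp (gam k * N) * Real.exp (-(rate (gam k * α) (N / 2) *
      (Real.exp s / (4 * n ^ 2)))) ≤ Real.exp (-(3 * Real.log n)) := by
    rw [← Real.exp_add]
    refine Real.exp_le_exp.2 (le_trans ?_ h5)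
    rw [rate, ← mul_div_assoc, ← Real.exp_add, ← sub_eq_add_neg]
    have : Real.exp (s - gam k * α * (N / 2)) ≤
        Real.exp (-(gam k * α * ((N / 2 : ℕ) : ℝ)) + s) := Real.exp_le_exp.2 (by
      have := mul_le_mul_of_nonneg_left hl2 hA.le
      linarith)
    gcongr
  rw [hexp] at e1 e2 e3
  calc _ ≤ n * (1 / n ^ 3 + 1 / n ^ 3) + n * (1 / n ^ 3) := by
        refine add_le_add (mul_le_mul_of_nonneg_left (add_le_add e1 e2) hn0.le) ?_
        rw [mul_left_comm]
        exact mul_le_mul_of_nonneg_left e3 hn0.le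
    _ = 3 / n ^ 2 := by field_simp; ring

/-- A break by time e^s is also a break by any later time, so each level N needs testing only at the
last s with hUpper(e^s) ≤ N, where equality holds. -/
lemma ae_forall_lt_breakTime (hk : 2 ≤ k) (hα : 0 < α)
    (hL : ∀ v, Measurable (L v)) (hind : iIndepFun L P)
    (hlaw : ∀ v, HasLaw (L v) (expMeasure (rate (gam k * α) v.length)) P) :
    ∃ s₁ : ℝ, ∀ᵐ ω ∂P, ∃ N₁ : ℕ, ∀ N, N₁ ≤ N → ∀ s, s₁ ≤ s → hUpper k α (Real.exp s) ≤ N →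
      ∀ v : List (Fin k), v.length = N → Real.exp s < breakTime (fun w => L w ω) v := by
  obtain ⟨s₁, hs₁⟩ := eventually_atTop.1 ((eventually_measureReal_exists_breakTime_le (P := P) hk hα
    hL hind hlaw).and (eventually_gt_atTop 0))
  obtain ⟨N₀, hN₀⟩ := exists_nat_ge (hUpper k α (Real.exp s₁))
  have hcont : ContinuousOn (fun s => hUpper k α (Real.exp s)) (Set.Ici s₁) :=
    continuousOn_hUpper_exp.mono fun s hs => (hs₁ s hs).2
  have hex : ∀ N : ℕ, ∃ b, N₀ ≤ N → s₁ ≤ b ∧ hUpper k α (Real.exp b) = N ∧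
      ∀ s, s₁ ≤ s → hUpper k α (Real.exp s) ≤ N → s ≤ b := by
    intro N
    by_cases hN : N₀ ≤ N
    · obtain ⟨b, hb⟩ := exists_last_eq hcont (tendsto_hUpper_exp hk hα)
        (hN₀.trans (by exact_mod_cast hN : (N₀ : ℝ) ≤ N))
      exact ⟨b, fun _ => hb⟩
    · exact ⟨0, fun h => absurd h hN⟩
  choose b hb using hex
  refine ⟨s₁, ?_⟩
  filter_upwards [ae_eventually_notMem_of_le (P := P) zero_le_one (N₀ := N₀) fun N hN =>
    (hs₁ (b N) (hb N hN).1).1 N (hb N hN).2.1] with ω hω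
  obtain ⟨N₁, hN₁⟩ := hω
  refine ⟨max N₀ N₁, fun N hN s hs hsN v hv => ?_⟩
  by_contra! hcon
  refine hN₁ N (le_of_max_le_right hN) ⟨v, hv, hcon.trans (Real.exp_le_exp.2 ?_)⟩
  exact (hb N (le_of_max_le_left hN)).2.2 s hs hsN

/-- Dually, each level N is tested at the first s with hLower(e^s) ≥ N. -/
lemma ae_exists_breakTime_le (hk : 2 ≤ k) (hα : 0 < α)
    (hL : ∀ v, Measurable (L v)) (hL0 : ∀ v ω, 0 ≤ L v ω) (hind : iIndepFun L P)
    (hlaw : ∀ v, HasLaw (L v) (expMeasure (rate (gam k * α) v.length)) P) :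
    ∃ s₁ : ℝ, ∀ᵐ ω ∂P, ∃ N₁ : ℕ, ∀ N : ℕ, N₁ ≤ N → ∀ s, s₁ ≤ s → N ≤ hLower k α (Real.exp s) →
      ∃ v : List (Fin k), v.length = N ∧ breakTime (fun w => L w ω) v ≤ Real.exp s := by
  obtain ⟨s₁, hs₁⟩ := eventually_atTop.1 ((eventually_measureReal_forall_lt_breakTime_le (P := P)
    hk hα hL hL0 hind hlaw).and (eventually_gt_atTop 0))
  obtain ⟨N₀, hN₀⟩ := exists_nat_ge (hLower k α (Real.exp s₁))
  have hcont : ContinuousOn (fun s => hLower k α (Real.exp s)) (Set.Ici s₁) :=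
    continuousOn_hLower_exp.mono fun s hs => (hs₁ s hs).2
  have hex : ∀ N : ℕ, ∃ b, N₀ ≤ N → s₁ ≤ b ∧ hLower k α (Real.exp b) = N ∧
      ∀ s, s₁ ≤ s → N ≤ hLower k α (Real.exp s) → b ≤ s := by
    intro N
    by_cases hN : N₀ ≤ N
    · obtain ⟨b, hb⟩ := exists_first_eq hcont (tendsto_hLower_exp hk hα)
        (hN₀.trans (by exact_mod_cast hN : (N₀ : ℝ) ≤ N))
      exact ⟨b, fun _ => hb⟩
    · exact ⟨0, fun h => absurd h hN⟩
  choose b hb using hex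
  refine ⟨s₁, ?_⟩
  filter_upwards [ae_eventually_notMem_of_le (P := P) (show (0 : ℝ) ≤ 3 by norm_num) (N₀ := N₀)
    fun N hN => (hs₁ (b N) (hb N hN).1).1 N (hb N hN).2.1] with ω hω
  obtain ⟨N₁, hN₁⟩ := hω
  refine ⟨max N₀ N₁, fun N hN s hs hsN => ?_⟩
  by_contra! hcon
  refine hN₁ N (le_of_max_le_right hN) fun v hv => lt_of_le_of_lt (Real.exp_le_exp.2 ?_)
    (hcon v hv)
  exact (hb N (le_of_max_le_left hN)).2.2 s hs hsN

end

end RegularFragmentation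

/-! ### From break times to the smallest fragment. -/

namespace RegularFragmentation

open Filter Topology

section Deterministic

variable {k : ℕ} {L : List (Fin k) → ℝ} {t : ℝ}

/-- Some interval of level `n` is created by time `t`. -/
def Reached (L : List (Fin k) → ℝ) (t : ℝ) (n : ℕ) : Prop :=
  ∃ v : List (Fin k), v.length = n ∧ creationTime L v ≤ t

lemma reached_zero (ht : 0 ≤ t) : Reached L t 0 := ⟨[], rfl, ht⟩

lemma reached_succ (hk : 0 < k) {n : ℕ} :
    Reached L t (n + 1) ↔ ∃ v : List (Fin k), v.length = n ∧ breakTime L v ≤ t := by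
  constructor
  · rintro ⟨_ | ⟨d, v⟩, hv, h⟩
    · simp at hv
    · exact ⟨v, by simpa using hv, h⟩
  · rintro ⟨v, hv, h⟩
    exact ⟨⟨0, hk⟩ :: v, by simp [hv], h⟩

lemma volume_interval (v : List (Fin k)) : (volume (interval v)).toReal = size v := by
  have : 0 ≤ size v := zpow_nonneg k.cast_nonneg _
  rw [interval, Real.volume_Ico, add_sub_cancel_left, ENNReal.toReal_ofReal this]

lemma isLeast_fragmentSizes (hk : 0 < k) {M : ℕ} (hM : Reached L t M)
    (hmax : ∀ n, M < n → ¬ Reached L t n) :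
    IsLeast (fragmentSizes {J | ∃ v : List (Fin k), J = interval v ∧
      creationTime L v ≤ t ∧ t < breakTime L v}) ((k : ℝ) ^ (-(M : ℤ))) := by
  constructor
  · obtain ⟨v, hv, h⟩ := hM
    refine ⟨interval v, ⟨v, rfl, h, ?_⟩, (volume_interval v).trans (by rw [size, hv])⟩
    by_contra! hcon
    exact hmax (M + 1) (by omega) ((reached_succ hk).2 ⟨v, hv, hcon⟩)
  · rintro _ ⟨_, ⟨v, rfl, h, -⟩, rfl⟩
    have hvM : v.length ≤ M := by
      by_contra! hcon
      exact hmax _ hcon ⟨v, rfl, h⟩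
    simp only [volume_interval, size]
    exact zpow_le_zpow_right₀ (by exact_mod_cast hk) (by omega)

lemma exists_max_reached (ht : 0 ≤ t) {n₀ : ℕ} (hn : ∀ n, n₀ ≤ n → ¬ Reached L t n) :
    ∃ M, Reached L t M ∧ ∀ n, M < n → ¬ Reached L t n := by
  classical
  refine ⟨Nat.findGreatest (Reached L t) n₀,
    Nat.findGreatest_spec (Nat.zero_le _) (reached_zero ht), fun n h1 h2 => ?_⟩
  rcases le_or_gt n n₀ with h | h
  · exact Nat.findGreatest_is_greatest h1 h h2
  · exact hn n h.le h2

/-- Since b ≤ a + 1, the two roundings differ by at most one; both inequalities being strict serves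
both conventions for the ceiling. -/
lemma ceil_and_floor_of_between {a b : ℝ} {m : ℕ} (hba : b ≤ a + 1) (h1 : a < m)
    (h2 : (m : ℝ) < b + 1) :
    ((m : ℤ) = ⌈a⌉ ∨ (m : ℤ) = ⌈b⌉) ∧ ((m : ℤ) = ⌊a⌋ + 1 ∨ (m : ℤ) = ⌊b⌋ + 1) := by
  have c1 : ⌈a⌉ ≤ (m : ℤ) := Int.ceil_le.2 (by exact_mod_cast h1.le)
  have c2 : (m : ℤ) - 1 < ⌈b⌉ := Int.lt_ceil.2 (by push_cast; linarith)
  have c3 : ⌈b⌉ ≤ ⌈a⌉ + 1 := by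
    have := Int.ceil_mono hba
    rwa [Int.ceil_add_one] at this
  have f1 : ⌊a⌋ < (m : ℤ) := Int.floor_lt.2 (by exact_mod_cast h1)
  have f2 : (m : ℤ) - 1 ≤ ⌊b⌋ := Int.le_floor.2 (by push_cast; linarith)
  have f3 : ⌊b⌋ ≤ ⌊a⌋ + 1 := by
    have := Int.floor_mono hba
    rwa [Int.floor_add_one] at this
  omega

end Deterministic

section

variable {k : ℕ} {α : ℝ}

lemma size_rpow (hk : 2 ≤ k) (v : List (Fin k)) : size v ^ α = rate (gam k * α) v.length := by
  have hk0 : (0 : ℝ) < k := by positivity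
  rw [size, rate, Real.rpow_def_of_pos (zpow_pos hk0 _), Real.log_zpow, gam]
  push_cast
  congr 1; ring

lemma ae_nonneg_expMeasure (r : ℝ) : ∀ᵐ x ∂(expMeasure r), 0 ≤ x := by
  rw [ae_iff]
  have : {x : ℝ | ¬ 0 ≤ x} = Set.Iio 0 := by ext; simp
  rw [this]
  refine (withDensity_apply _ measurableSet_Iio).trans ?_
  exact lintegral_exponentialPDF_of_nonpos le_rfl

lemma tendsto_of_comp_exp {f : ℝ → ℝ} (h : Tendsto (fun s => f (Real.exp s)) atTop atTop) :
    Tendsto f atTop atTop := by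
  refine (h.comp Real.tendsto_log_atTop).congr' ?_
  filter_upwards [eventually_gt_atTop 0] with t ht
  simp [Real.exp_log ht]

lemma eventually_hUpper_le (k : ℕ) (α : ℝ) :
    ∀ᶠ t in atTop, hUpper k α t ≤ hLower k α t + 1 := by
  have h1 : Tendsto (fun t => mu2 k α * (1 / Real.log t ^ (1 / 3 : ℝ))) atTop (𝓝 0) := by
    have := (((tendsto_rpow_atTop (show (0 : ℝ) < 1 / 3 by norm_num)).comp
      Real.tendsto_log_atTop).inv_tendsto_atTop).const_mul (mu2 k α)
    rw [mul_zero] at this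
    simpa [one_div] using this
  filter_upwards [h1.eventually_le_const (show (0 : ℝ) < 1 / 2 by norm_num)] with t ht
  rw [hLower, hUpper]
  linarith

lemma exists_max_level (hk : 2 ≤ k) (hα : 0 < α) {L : List (Fin k) → ℝ} {s₁ s₂ : ℝ} {N₁ N₂ : ℕ}
    (hup : ∀ N, N₁ ≤ N → ∀ s, s₁ ≤ s → hUpper k α (Real.exp s) ≤ N →
      ∀ v : List (Fin k), v.length = N → Real.exp s < breakTime L v)
    (hlow : ∀ N : ℕ, N₂ ≤ N → ∀ s, s₂ ≤ s → N ≤ hLower k α (Real.exp s) →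
      ∃ v : List (Fin k), v.length = N ∧ breakTime L v ≤ Real.exp s) :
    ∃ M : ℝ → ℕ, (∀ t, 0 ≤ t → Reached L t (M t) ∧ ∀ n, M t < n → ¬ Reached L t n) ∧
      ∃ t₀ : ℝ, 0 ≤ t₀ ∧ ∀ t, t₀ ≤ t → hLower k α t < M t ∧ (M t : ℝ) < hUpper k α t + 1 := by
  have hk0 : 0 < k := by omega
  have hex : ∀ t : ℝ, ∃ M, 0 ≤ t → Reached L t M ∧ ∀ n, M < n → ¬ Reached L t n := by
    intro t
    by_cases ht : 0 ≤ t
    · set s := max s₁ (Real.log (t + 1)) with hs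
      have hts : t ≤ Real.exp s := by
        have := Real.exp_le_exp.2 (le_max_right s₁ (Real.log (t + 1)))
        rw [Real.exp_log (by linarith)] at this
        linarith
      obtain ⟨n₀, hn₀⟩ := exists_nat_ge (hUpper k α (Real.exp s))
      obtain ⟨M, hM⟩ := exists_max_reached (L := L) ht (n₀ := max n₀ N₁ + 1) (fun n hn hr => by
        obtain ⟨n, rfl⟩ := Nat.exists_eq_add_of_le' (show 1 ≤ n by omega)
        obtain ⟨v, hv, h⟩ := (reached_succ hk0).1 hr
        have h1 : max n₀ N₁ ≤ n := by omega
        have h2 : (n₀ : ℝ) ≤ n := by exact_mod_cast le_of_max_le_left h1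
        have := hup n (le_of_max_le_right h1) s (le_max_left _ _) (hn₀.trans h2) v hv
        linarith)
      exact ⟨M, fun _ => hM⟩
    · exact ⟨0, fun h => absurd h ht⟩
  choose M hM using hex
  refine ⟨M, hM, ?_⟩
  have hev : ∀ᶠ t : ℝ in atTop, hLower k α t < M t ∧ (M t : ℝ) < hUpper k α t + 1 := by
    filter_upwards [eventually_gt_atTop 0, Real.tendsto_log_atTop.eventually_ge_atTop s₁,
      Real.tendsto_log_atTop.eventually_ge_atTop s₂,
      (tendsto_of_comp_exp (tendsto_hLower_exp hk hα)).eventually_ge_atTop (N₂ : ℝ),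
      (tendsto_of_comp_exp (tendsto_hUpper_exp hk hα)).eventually_ge_atTop (N₁ : ℝ)]
      with t ht hs₁ hs₂ hN₂ hN₁
    obtain ⟨hreach, hmax⟩ := hM t ht.le
    constructor
    · by_contra! hcon
      -- The maximum is taken because `hlow` starts at level N₂; both numbers are at most hLower(t),
      -- and a break at this level contradicts the maximality of M t.
      obtain ⟨v, hv, h⟩ := hlow (max (M t) N₂) (le_max_right _ _) (Real.log t) hs₂
        (by rw [Real.exp_log ht]; push_cast; exact max_le hcon hN₂)
      rw [Real.exp_log ht] at h
      exact hmax (max (M t) N₂ + 1) (by have := le_max_left (M t) N₂; omega)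
        ((reached_succ hk0).2 ⟨v, hv, h⟩)
    · by_contra! hcon
      have h0 : N₁ + 1 ≤ M t := by
        have : (N₁ : ℝ) + 1 ≤ M t := by linarith
        exact_mod_cast this
      obtain ⟨n, hn⟩ := Nat.exists_eq_add_of_le' (show 1 ≤ M t by omega)
      rw [hn] at hreach hcon
      obtain ⟨v, hv, h⟩ := (reached_succ hk0).1 hreach
      have := hup n (by omega) (Real.log t) hs₁
        (by rw [Real.exp_log ht]; push_cast at hcon; linarith) v hv
      rw [Real.exp_log ht] at this
      linarith
  obtain ⟨t₀, ht₀⟩ := eventually_atTop.1 hev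
  exact ⟨max t₀ 0, le_max_right _ _, fun t ht => ht₀ t (le_of_max_le_left ht)⟩

end

end RegularFragmentation

/-! ### Conclusion. -/

open RegularFragmentation Filter

theorem theoremB {Ω : Type*} [MeasurableSpace Ω] (P : Measure Ω) [IsProbabilityMeasure P]
    (k : ℕ) (hk : 2 ≤ k) (α : ℝ) (hα : 0 < α)
    (I : ℝ → Ω → Set (Set ℝ))
    (hI : RegularFragmentation.IsRegularFragmentation P k α I) :
    ∀ᵐ ω ∂P, ∃ M : ℝ → ℕ,
      (∀ t : ℝ, 0 ≤ t →
        IsLeast (RegularFragmentation.fragmentSizes (I t ω)) ((k : ℝ) ^ (-(M t : ℤ)))) ∧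
      ∃ t₀ : ℝ, 0 ≤ t₀ ∧ ∀ t : ℝ, t₀ ≤ t →
        -- with `⌈x⌉` the least integer `≥ x`
        ((M t : ℤ) = ⌈RegularFragmentation.hLower k α t⌉ ∨
          (M t : ℤ) = ⌈RegularFragmentation.hUpper k α t⌉) ∧
        -- with the least integer `> x` instead, which is `⌊x⌋ + 1`
        ((M t : ℤ) = ⌊RegularFragmentation.hLower k α t⌋ + 1 ∨
          (M t : ℤ) = ⌊RegularFragmentation.hUpper k α t⌋ + 1) := by
  obtain ⟨L, hlaw, hind, hIL⟩ := hI
  simp_rw [size_rpow hk] at hlaw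
  have hmeas : ∀ v, AEMeasurable (L v) P := fun v => (hlaw v).aemeasurable
  -- The laws give measurability and nonnegativity only almost everywhere. There are countably many
  -- words, so almost surely no waiting time is changed.
  set L' : List (Fin k) → Ω → ℝ := fun v ω => max ((hmeas v).mk (L v) ω) 0 with hL'
  have hLm : ∀ v, Measurable (L' v) := fun v => (hmeas v).measurable_mk.max measurable_const
  have hL0 : ∀ v ω, 0 ≤ L' v ω := fun v ω => le_max_right _ _
  have heq : ∀ v, L' v =ᵐ[P] L v := by
    intro v
    have h0 : ∀ᵐ ω ∂P, 0 ≤ L v ω :=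
      ((hlaw v).ae_iff (p := fun x => 0 ≤ x) measurableSet_Ici.mem).2 (ae_nonneg_expMeasure _)
    filter_upwards [h0, (hmeas v).ae_eq_mk] with ω h1 h2
    simp only [hL', ← h2, max_eq_left h1]
  have hind' : iIndepFun L' P := hind.congr fun v => (heq v).symm
  have hlaw' : ∀ v, HasLaw (L' v) (expMeasure (rate (gam k * α) v.length)) P :=
    fun v => (hlaw v).congr (heq v)
  obtain ⟨s₁, h1⟩ := ae_forall_lt_breakTime hk hα hLm hind' hlaw'
  obtain ⟨s₂, h2⟩ := ae_exists_breakTime_le hk hα hLm hL0 hind' hlaw'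
  filter_upwards [hIL, ae_all_iff.2 heq, h1, h2] with ω hω hωeq ⟨N₁, hN₁⟩ ⟨N₂, hN₂⟩
  have hLL : (fun w => L w ω) = fun w => L' w ω := funext fun w => (hωeq w).symm
  rw [hLL] at hω
  obtain ⟨M, hM, t₀, ht₀, hMt⟩ := exists_max_level hk hα hN₁ hN₂
  obtain ⟨t₁, ht₁⟩ := eventually_atTop.1 (eventually_hUpper_le k α)
  refine ⟨M, fun t ht => ?_, max t₀ t₁, le_max_of_le_left ht₀, fun t ht => ?_⟩
  · rw [hω t ht]
    exact isLeast_fragmentSizes (by omega) (hM t ht).1 (hM t ht).2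
  · obtain ⟨h5, h6⟩ := hMt t (le_of_max_le_left ht)
    exact ceil_and_floor_of_between (ht₁ t (le_of_max_le_right ht)) h5 h6
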